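/- Let $\mathcal G=(\mathcal V,\mathcal E)$ be a finite simple graph with $n$ nodes, and consider a Gaussian graphical model $p(x)\propto\exp\{-\tfrac12x^TJx+h^Tx\}$ on $\mathcal G$: $J$ is a real symmetric positive definite matrix with $J_{ij}=0$ whenever $i\neq j$ are not adjacent, and $h\in\mathbb R^{\mathcal V}$; its exact covariance matrix is $P=J^{-1}$. Assume that $J$ has unit diagonal, put $R=I-J$ and $\bar R=(|R_{ij}|)_{ij}$, and let the weight of a walk in $\mathcal G$ be the product of the entries of $R$ along its steps. Assume that the model is walk-summable: for all $i,j$ the sum of the weights of all walks from $i$ to $j$ converges in every order of the summands. Loopy belief propagation (LBP) for $(J,h)$ on a graph starts from $\Delta J^{(0)}_{i\to j}=\Delta h^{(0)}_{i\to j}=0$ and iterates $$\Delta J^{(t)}_{i\to j}=-J_{ji}\bigl(\hat J^{(t-1)}_{i\setminus j}\bigr)^{-1}J_{ij},\qquad \Delta h^{(t)}_{i\to j}=-J_{ji}\bigl(\hat J^{(t-1)}_{i\setminus j}\bigr)^{-1}\hat h^{(t-1)}_{i\setminus j}$$ along the edges, where $\hat J^{(t)}_{i\setminus j}=J_{ii}+\sum_{k\in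 N(i)\setminus j}\Delta J^{(t)}_{k\to i}$ and $\hat h^{(t)}_{i\setminus j}=h_i+\sum_{k\in N(i)\setminus j}\Delta h^{(t)}_{k\to i}$. From the limiting messages it computes $\hat J_i=J_{ii}+\sum_{k\in N(i)}\Delta J_{k\to i}$ and $\hat h_i=h_i+\sum_{k\in N(i)}\Delta h_{k\to i}$, and returns the variances $\hat J_i^{-1}$ and the means $\hat J_i^{-1}\hat h_i$. Let $F\subseteq\mathcal V$ be a set of $k$ feedback nodes, let $T=\mathcal V\setminus F$, and let $\widetilde{\mathcal T}$ be the subgraph of $\mathcal G$ induced by $T$. Approximate feedback message passing (FMP) with $F$ proceeds as follows. 1. Run LBP on $\widetilde{\mathcal T}$ with $J_T$ and the potentials $h_T$, which gives partial means $\mu^T$ and partial variances $P^T_{ii}$, and with $J_T$ and the potentials $J_{T,p}$ for each $p\in F$, which gives, as means, the feedback gains $g^p$. 2. For $p,q\in F$ put $(\hat J_F)_{pq}=J_{pq}-\sum_{j\in N(p)\cap T}J_{pj}g^q_j$ and $(\hat h_F)_p=h_p-\sum_{j\in N(p)\cap T}J_{pj}\mu^T_j$; set $P_F=\hat J_F^{-1}$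 and $\mu_F=P_F\hat h_F$. These are the means, and the diagonal entries of $P_F$ the variances, returned on $F$. 3. Run LBP on $\widetilde{\mathcal T}$ with $J_T$ and the potentials $\tilde h_i=h_i-\sum_{j\in N(i)\cap F}J_{ij}(\mu_F)_j$; its means are those returned on $T$. The variance returned for $i\in T$ is $P^T_{ii}+\sum_{p,q\in F}g^p_i(P_F)_{pq}g^q_i$. Then approximate FMP is well defined (it never divides by zero and $\hat J_F$ is invertible) and converges, and the variances $\widehat P^{\mathrm{FMP}}_{ii}$ that it returns satisfy $$\epsilon_{\mathrm{FMP}}=\frac1n\sum_{i\in\mathcal V}\bigl|\widehat P^{\mathrm{FMP}}_{ii}-P_{ii}\bigr|\le\frac{n-k}{n}\,\frac{\tilde\rho^{\,\tilde g}}{1-\tilde\rho},$$ where $\tilde\rho$ is the spectral radius of the restriction of $\bar R$ to $T$, and $\tilde g$ is the girth of $\widetilde{\mathcal T}$, i.e. the length of its shortest cycle (if there is no cycle, then $\tilde g=\infty$ and $\tilde\rho^{\,\tilde g}=0$). In particular, LBP on the entire graph with $(J,h)$ is well defined and converges, and its variances satisfy $$\epsilon_{\mathrm{LBP}}=\frac1n\sum_{i\in\mathcal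 V}\bigl|\widehat P^{\mathrm{LBP}}_{ii}-P_{ii}\bigr|\le\frac{\rho^{g}}{1-\rho},$$ where $\rho$ is the spectral radius of $\bar R$ and $g$ is the girth of $\mathcal G$. -/

import Mathlib

open Filter Topology

section GaussianInference

variable {V : Type*} [Fintype V]

/-! ### Walk-sums -/

/-- The edge-weight matrix `R = I - J`. -/
def edgeWeight [DecidableEq V] (J : Matrix V V ℝ) : Matrix V V ℝ := 1 - J

/-- The weight of a walk: the product of the edge weights along its steps
(in particular `1` for a walk of length zero). -/
def walkWeight {G : SimpleGraph V} (R : Matrix V V ℝ) {i j : V} (w : G.Walk i j) : ℝ :=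
  (w.darts.map fun d => R d.fst d.snd).prod

/-- Walk-summability: for all `i, j`, the sum of the weights of all walks from `i` to `j`
converges in any order of the summands (this is what `Summable` says). -/
def IsWalkSummable [DecidableEq V] (G : SimpleGraph V) (J : Matrix V V ℝ) : Prop :=
  ∀ i j : V, Summable fun w : G.Walk i j => walkWeight (edgeWeight J) w

/-- `R̄`, the matrix of absolute values of the edge weights. -/
def absEdgeWeight [DecidableEq V] (J : Matrix V V ℝ) : Matrix V V ℝ :=
  (edgeWeight J).map fun x => |x|

/-- The spectral radius `ρ(R̄)`. For a symmetric `J` the matrix `R̄` is real symmetric, so that its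
real spectrum is all of its spectrum. -/
noncomputable def absSpectralRadius [DecidableEq V] (J : Matrix V V ℝ) : ℝ :=
  (spectralRadius ℝ (absEdgeWeight J)).toReal

/-- `ρ ^ g` for a possibly infinite girth `g` and `0 ≤ ρ < 1`; it is `0` for `g = ∞`. -/
noncomputable def powGirth (ρ : ℝ) (g : ℕ∞) : ℝ :=
  if g = ⊤ then 0 else ρ ^ g.toNat

/-! ### Loopy belief propagation -/

open Classical in
/-- `a i + ∑ m (k → i)` over the neighbours `k ≠ j` of `i`. -/
noncomputable def cavity (G : SimpleGraph V) (a : V → ℝ) (m : V → V → ℝ) (i j : V) : ℝ :=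
  a i + ∑ k with G.Adj i k ∧ k ≠ j, m k i

open Classical in
/-- `a i + ∑ m (k → i)` over all neighbours `k` of `i`. -/
noncomputable def belief (G : SimpleGraph V) (a : V → ℝ) (m : V → V → ℝ) (i : V) : ℝ :=
  a i + ∑ k with G.Adj i k, m k i

/-- The messages `ΔJ (i → j)` of loopy belief propagation after `t` iterations, started at `0`.
(Only those with `i`, `j` adjacent are used.) -/
noncomputable def lbpDeltaJ (G : SimpleGraph V) (J : Matrix V V ℝ) : ℕ → V → V → ℝ
  | 0 => fun _ _ => 0
  | t + 1 => fun i j => -J j i * (cavity G J.diag (lbpDeltaJ G J t) i j)⁻¹ * J i j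

/-- The messages `Δh (i → j)` of loopy belief propagation after `t` iterations, started at `0`. -/
noncomputable def lbpDeltaH (G : SimpleGraph V) (J : Matrix V V ℝ) (h : V → ℝ) :
    ℕ → V → V → ℝ
  | 0 => fun _ _ => 0
  | t + 1 => fun i j =>
      -J j i * (cavity G J.diag (lbpDeltaJ G J t) i j)⁻¹ * cavity G h (lbpDeltaH G J h t) i j

/-- Loopy belief propagation on `G` with information matrix `J` and potential vector `h`, started
at zero messages, is well defined (no division by zero), its messages converge, and the means and
variances computed from the limiting messages are `μ` and `P`. -/
def IsLBPOutput (G : SimpleGraph V) (J : Matrix V V ℝ) (h μ P : V → ℝ) : Prop :=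
  (∀ t i j, G.Adj i j → cavity G J.diag (lbpDeltaJ G J t) i j ≠ 0) ∧
  ∃ ΔJ Δh : V → V → ℝ,
    (∀ i j, G.Adj i j → Tendsto (fun t => lbpDeltaJ G J t i j) atTop (𝓝 (ΔJ i j))) ∧
    (∀ i j, G.Adj i j → Tendsto (fun t => lbpDeltaH G J h t i j) atTop (𝓝 (Δh i j))) ∧
    (∀ i, belief G J.diag ΔJ i ≠ 0) ∧
    (∀ i, P i = (belief G J.diag ΔJ i)⁻¹) ∧
    (∀ i, μ i = (belief G J.diag ΔJ i)⁻¹ * belief G h Δh i)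

/-! ### Approximate feedback message passing -/

variable [DecidableEq V]

/-- The graph that remains when the feedback nodes `F` (and their edges) are removed. -/
abbrev remainingGraph (G : SimpleGraph V) (F : Finset V) : SimpleGraph {i // i ∉ F} :=
  G.comap Subtype.val

/-- The information matrix restricted to the nodes outside `F`. -/
abbrev remainingInfo (J : Matrix V V ℝ) (F : Finset V) :
    Matrix {i // i ∉ F} {i // i ∉ F} ℝ :=
  J.submatrix Subtype.val Subtype.val

open Classical in
/-- The information matrix `Ĵ_F` of the small inference problem on the feedback nodes, computed
from the feedback gains `g`. -/
noncomputable def feedbackInfo (G : SimpleGraph V) (J : Matrix V V ℝ) (F : Finset V)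
    (g : {p // p ∈ F} → {i // i ∉ F} → ℝ) : Matrix {p // p ∈ F} {p // p ∈ F} ℝ :=
  Matrix.of fun p q => J p q - ∑ j : {i // i ∉ F} with G.Adj p.1 j.1, J p j * g q j

open Classical in
/-- The potential vector `ĥ_F` of the small inference problem on the feedback nodes, computed
from the partial means `μT`. -/
noncomputable def feedbackPotential (G : SimpleGraph V) (J : Matrix V V ℝ) (h : V → ℝ)
    (F : Finset V) (μT : {i // i ∉ F} → ℝ) : {p // p ∈ F} → ℝ :=
  fun p => h p - ∑ j : {i // i ∉ F} with G.Adj p.1 j.1, J p j * μT j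

open Classical in
/-- The revised potential vector on the remaining nodes, given the means `μF` of the feedback
nodes. -/
noncomputable def revisedPotential (G : SimpleGraph V) (J : Matrix V V ℝ) (h : V → ℝ)
    (F : Finset V) (μF : {p // p ∈ F} → ℝ) : {i // i ∉ F} → ℝ :=
  fun i => h i - ∑ p : {p // p ∈ F} with G.Adj i.1 p.1, J i p * μF p

/-- Approximate feedback message passing with the set `F` of feedback nodes is well defined and
converges (that is, each of its runs of loopy belief propagation on the remaining graph does), and
its output means and variances are `μ` and `P`. Here `μT`, `PT` are the partial means and
variances, `g p` the feedback gains of the feedback node `p`, `μF` the means of the feedback nodes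
and `νT` the means from the second round. (The variance computations of all runs are the same.) -/
def IsApproxFMPOutput (G : SimpleGraph V) (J : Matrix V V ℝ) (h : V → ℝ) (F : Finset V)
    (μ P : V → ℝ) : Prop :=
  ∃ (μT PT νT : {i // i ∉ F} → ℝ) (g : {p // p ∈ F} → {i // i ∉ F} → ℝ)
    (μF : {p // p ∈ F} → ℝ) (PF : Matrix {p // p ∈ F} {p // p ∈ F} ℝ),
    -- first round
    IsLBPOutput (remainingGraph G F) (remainingInfo J F) (fun i => h i) μT PT ∧
    (∀ p : {p // p ∈ F}, IsLBPOutput (remainingGraph G F) (remainingInfo J F) (fun i => J i p) (g p) PT) ∧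
    -- inference on the feedback nodes
    IsUnit (feedbackInfo G J F g).det ∧
    PF = (feedbackInfo G J F g)⁻¹ ∧
    μF = Matrix.mulVec PF (feedbackPotential G J h F μT) ∧
    -- second round
    IsLBPOutput (remainingGraph G F) (remainingInfo J F) (revisedPotential G J h F μF) νT PT ∧
    -- output
    (∀ p : {p // p ∈ F}, μ p = μF p) ∧
    (∀ i : {i // i ∉ F}, μ i = νT i) ∧
    (∀ p : {p // p ∈ F}, P p = PF p p) ∧
    (∀ i : {i // i ∉ F}, P i = PT i + ∑ p, ∑ q, g p i * PF p q * g q i)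

/-- The average absolute error of the variances `P` as compared to the exact variances, the
diagonal entries of `J⁻¹`. -/
noncomputable def varianceError (J : Matrix V V ℝ) (P : V → ℝ) : ℝ :=
  1 / (Fintype.card V : ℝ) * ∑ i, |P i - J⁻¹ i i|

end GaussianInference

/-! ### Powers and Neumann series of symmetric matrices -/

section MatrixPowers

variable {V : Type*} [Fintype V] [DecidableEq V]

/-! Write A for `absEdgeWeight J`. Over the reals, convergence in every order is absolute
convergence, so the Neumann series N = ∑ A ^ l converges entrywise, and its row sums form a vector v
≥ 1 with v = 1 + A v (`isDominating_absEdgeWeight`). This one vector controls loopy belief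
propagation: by induction the negated precision messages stay below A i j * v i / v j, so the cavity
precisions stay positive, and the messages increase to a fixed point X
(`exists_tendsto_precisionMessage`).

The potential messages have the explicit equilibrium D i j = R i j * μ i - X i j * μ j with μ = J⁻¹
h. Their errors contract when measured against the equilibrium that belongs to v, up to a
perturbation tending to zero (`tendsto_potentialMessage`). In particular the means are exact.

For the variances put b i = 1 - ∑ X k i, so that the computed variance is 1 / b i. With h the unit
vector at i, the belief identity reads b i * J⁻¹ i i = 1 + ∑ D k i, so the D k i make up the error.
Comparison with the same identity for A in place of R gives |∑ D k i| ≤ b i * N i i - 1. On the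
other hand, walks reduce to non-backtracking walks (`neumann_mul_le`), and below the girth no
non-backtracking walk returns to i, whence b i * ∑_{l < n} (A ^ l) i i ≤ 1 for n up to the girth.
The error is therefore at most the tail ∑_{l ≥ n} (A ^ l) i i (`abs_inv_sub_le`), which the spectral
theorem bounds by ρ ^ n / (1 - ρ).

For feedback message passing, exactness of the means makes the feedback gains exact. The matrix on F
is then the true Schur complement, and block inversion leaves no error on F and only the error of
the partial variances on T. -/

theorem Matrix.IsHermitian.pow_apply_eq_sum_eigenvalues {A : Matrix V V ℝ} (hA : A.IsHermitian)
    (l : ℕ) (i : V) :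
    (A ^ l) i i = ∑ k, (hA.eigenvectorUnitary : Matrix V V ℝ) i k ^ 2 * hA.eigenvalues k ^ l := by
  conv_lhs => rw [hA.spectral_theorem, ← map_pow, Matrix.diagonal_pow,
    Unitary.conjStarAlgAut_apply, Matrix.mul_apply]
  refine Finset.sum_congr rfl fun k _ => ?_
  rw [Matrix.mul_diagonal]
  simp [Matrix.star_apply]
  ring

theorem Matrix.IsHermitian.sum_eigenvectorUnitary_sq {A : Matrix V V ℝ} (hA : A.IsHermitian)
    (i : V) : ∑ k, (hA.eigenvectorUnitary : Matrix V V ℝ) i k ^ 2 = 1 := by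
  simpa using (hA.pow_apply_eq_sum_eigenvalues 0 i).symm

theorem Matrix.IsHermitian.spectralRadius_eq_iSup {A : Matrix V V ℝ} (hA : A.IsHermitian) :
    spectralRadius ℝ A = ⨆ i, (‖hA.eigenvalues i‖₊ : ENNReal) := by
  rw [spectralRadius, hA.spectrum_real_eq_range_eigenvalues, iSup_range]

theorem Matrix.IsHermitian.abs_eigenvalues_le {A : Matrix V V ℝ} (hA : A.IsHermitian) (i : V) :
    |hA.eigenvalues i| ≤ (spectralRadius ℝ A).toReal := by
  have h1 : (‖hA.eigenvalues i‖₊ : ENNReal) ≤ spectralRadius ℝ A := by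
    rw [hA.spectralRadius_eq_iSup]
    exact le_iSup (fun i => (‖hA.eigenvalues i‖₊ : ENNReal)) i
  have h2 : spectralRadius ℝ A ≠ ⊤ := by
    rw [hA.spectralRadius_eq_iSup]
    have : Nonempty V := ⟨i⟩
    obtain ⟨j, hj⟩ := exists_eq_ciSup_of_finite (f := fun i => (‖hA.eigenvalues i‖₊ : ENNReal))
    rw [← hj]
    exact ENNReal.coe_ne_top
  simpa using ENNReal.toReal_mono h2 h1

/-- A diagonal entry of A ^ l is a weighted mean of the l-th powers of the eigenvalues, because the
rows of the eigenvector matrix are unit vectors. -/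
theorem Matrix.IsHermitian.pow_apply_le_spectralRadius_pow {A : Matrix V V ℝ}
    (hA : A.IsHermitian) (l : ℕ) (i : V) :
    (A ^ l) i i ≤ (spectralRadius ℝ A).toReal ^ l := by
  rw [hA.pow_apply_eq_sum_eigenvalues]
  calc _ ≤ ∑ k, (hA.eigenvectorUnitary : Matrix V V ℝ) i k ^ 2 *
        (spectralRadius ℝ A).toReal ^ l := by
        refine Finset.sum_le_sum fun k _ => mul_le_mul_of_nonneg_left ?_ (sq_nonneg _)
        refine (le_abs_self _).trans ?_
        rw [abs_pow]
        exact pow_le_pow_left₀ (abs_nonneg _) (hA.abs_eigenvalues_le k) l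
    _ = _ := by rw [← Finset.sum_mul, hA.sum_eigenvectorUnitary_sq, one_mul]

/-- On an eigenvector A ^ l acts as the l-th power of the eigenvalue, so decay of the powers forces
every eigenvalue into the open unit interval; the supremum over finitely many is attained. -/
theorem Matrix.IsHermitian.spectralRadius_lt_one {A : Matrix V V ℝ} (hA : A.IsHermitian)
    (h : ∀ i j, Tendsto (fun l => (A ^ l) i j) atTop (𝓝 0)) :
    (spectralRadius ℝ A).toReal < 1 := by
  have key : ∀ k, |hA.eigenvalues k| < 1 := by
    intro k
    have h1 : ∀ l : ℕ, (A ^ l).mulVec (hA.eigenvectorBasis k) =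
        hA.eigenvalues k ^ l • (hA.eigenvectorBasis k : V → ℝ) := by
      intro l
      induction l with
      | zero => simp
      | succ l ih =>
        rw [pow_succ, ← Matrix.mulVec_mulVec, hA.mulVec_eigenvectorBasis, Matrix.mulVec_smul, ih,
          smul_smul, pow_succ, mul_comm]
    obtain ⟨i, hi⟩ : ∃ i, (hA.eigenvectorBasis k : V → ℝ) i ≠ 0 := by
      by_contra! hc
      apply hA.eigenvectorBasis.orthonormal.ne_zero k
      ext i
      exact hc i
    have h2 : Tendsto (fun l : ℕ => hA.eigenvalues k ^ l * (hA.eigenvectorBasis k : V → ℝ) i)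
        atTop (𝓝 0) := by
      have : Tendsto (fun l : ℕ => ∑ j, (A ^ l) i j * (hA.eigenvectorBasis k : V → ℝ) j) atTop
          (𝓝 (∑ j, 0 * (hA.eigenvectorBasis k : V → ℝ) j)) :=
        tendsto_finsetSum _ fun j _ => (h i j).mul_const _
      simp only [zero_mul, Finset.sum_const_zero] at this
      refine this.congr fun l => ?_
      simpa [Matrix.mulVec, dotProduct] using congrFun (h1 l) i
    have h3 : Tendsto (fun l : ℕ => hA.eigenvalues k ^ l) atTop (𝓝 0) := by
      have := h2.mul_const ((hA.eigenvectorBasis k : V → ℝ) i)⁻¹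
      simpa [mul_assoc, mul_inv_cancel₀ hi] using this
    exact tendsto_pow_atTop_nhds_zero_iff.mp h3
  rw [hA.spectralRadius_eq_iSup]
  rcases isEmpty_or_nonempty V with hV | hV
  · simp
  · obtain ⟨j, hj⟩ := exists_eq_ciSup_of_finite (f := fun i => (‖hA.eigenvalues i‖₊ : ENNReal))
    rw [← hj]
    simpa using key j

/-- The Neumann series of a matrix, taken entrywise, solves `N = 1 + A N`. -/
theorem Matrix.tsum_pow_apply_eq {A : Matrix V V ℝ} (h : ∀ i j, Summable fun l => (A ^ l) i j)
    (i j : V) :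
    ∑' l, (A ^ l) i j = (1 : Matrix V V ℝ) i j + ∑ k, A i k * ∑' l, (A ^ l) k j := by
  rw [(h i j).tsum_eq_zero_add, pow_zero]
  congr 1
  simp_rw [pow_succ', Matrix.mul_apply, ← tsum_mul_left]
  rw [Summable.tsum_finsetSum fun k _ => (h k j).mul_left _]

/-- The tail of the Neumann series of a symmetric matrix is bounded on the diagonal by that of
the geometric series of the spectral radius. -/
theorem Matrix.IsHermitian.tsum_pow_apply_sub_le {A : Matrix V V ℝ} (hA : A.IsHermitian)
    (h : ∀ i j, Summable fun l => (A ^ l) i j) (n : ℕ) (i : V) :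
    ∑' l, (A ^ l) i i - ∑ l ∈ Finset.range n, (A ^ l) i i ≤
      (spectralRadius ℝ A).toReal ^ n / (1 - (spectralRadius ℝ A).toReal) := by
  have hlt := hA.spectralRadius_lt_one fun i j => (h i j).tendsto_atTop_zero
  have h0 : 0 ≤ (spectralRadius ℝ A).toReal := ENNReal.toReal_nonneg
  rw [← (h i i).sum_add_tsum_nat_add n, add_sub_cancel_left]
  have hs : HasSum (fun l => (spectralRadius ℝ A).toReal ^ (l + n))
      ((spectralRadius ℝ A).toReal ^ n / (1 - (spectralRadius ℝ A).toReal)) := by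
    simp_rw [pow_add, mul_comm _ ((spectralRadius ℝ A).toReal ^ n), div_eq_mul_inv]
    exact (hasSum_geometric_of_lt_one h0 hlt).mul_left _
  rw [← hs.tsum_eq]
  exact Summable.tsum_le_tsum (fun l => hA.pow_apply_le_spectralRadius_pow _ i)
    ((summable_nat_add_iff n).mpr (h i i)) hs.summable

theorem Matrix.submatrix_pow_apply_le {W : Type*} [Fintype W] [DecidableEq W]
    {A : Matrix V V ℝ} (h0 : ∀ i j, 0 ≤ A i j) {e : W → V} (he : Function.Injective e)
    (l : ℕ) (i j : W) : ((A.submatrix e e) ^ l) i j ≤ (A ^ l) (e i) (e j) := by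
  induction l generalizing i with
  | zero => simp [Matrix.one_apply, he.eq_iff]
  | succ l ih =>
    rw [pow_succ', pow_succ', Matrix.mul_apply, Matrix.mul_apply]
    calc _ ≤ ∑ k : W, A (e i) (e k) * (A ^ l) (e k) (e j) :=
          Finset.sum_le_sum fun k _ => mul_le_mul_of_nonneg_left (ih k) (h0 _ _)
      _ = ∑ k ∈ Finset.univ.map ⟨e, he⟩, A (e i) k * (A ^ l) k (e j) := by
          rw [Finset.sum_map]; rfl
      _ ≤ _ := Finset.sum_le_sum_of_subset_of_nonneg (Finset.subset_univ _)
          fun k _ _ => mul_nonneg (h0 _ _) (Matrix.pow_apply_nonneg h0 _ _ _)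

end MatrixPowers

/-! ### Walk-summability and powers of the absolute edge weights -/

section WalkSums

theorem walkWeight_cons {V : Type*} {G : SimpleGraph V} (R : Matrix V V ℝ) {i j k : V} (h : G.Adj i j)
    (w : G.Walk j k) : walkWeight R (SimpleGraph.Walk.cons h w) = R i j * walkWeight R w := by
  simp [walkWeight]

theorem abs_walkWeight {V : Type*} {G : SimpleGraph V} (R : Matrix V V ℝ) {i j : V} (w : G.Walk i j) :
    |walkWeight R w| = walkWeight (R.map fun x => |x|) w := by
  induction w with
  | nil => simp [walkWeight]
  | cons h w ih => simp [walkWeight_cons, abs_mul, ih]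

variable {V : Type*} [Fintype V] [DecidableEq V]

/-- The entries of the powers of a matrix supported on the edges of a graph are sums of
weights of walks. -/
theorem sum_walkWeight_eq_pow_apply (G : SimpleGraph V) [DecidableRel G.Adj] {R : Matrix V V ℝ}
    (hR : ∀ i j, ¬ G.Adj i j → R i j = 0) (l : ℕ) (i j : V) :
    ∑ w ∈ G.finsetWalkLength l i j, walkWeight R w = (R ^ l) i j := by
  induction l generalizing i with
  | zero =>
    obtain rfl | h := eq_or_ne i j
    · simp [SimpleGraph.finsetWalkLength, walkWeight]
    · simp [SimpleGraph.finsetWalkLength, h]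
  | succ l ih =>
    rw [pow_succ', Matrix.mul_apply, SimpleGraph.finsetWalkLength, Finset.sum_biUnion]
    · rw [← Finset.sum_subset (Finset.subset_univ (G.neighborFinset i))]
      · rw [Finset.sum_subtype (p := fun k => k ∈ G.neighborSet i) _ (fun x => by simp)]
        refine Finset.sum_congr rfl fun k _ => ?_
        rw [Finset.sum_map, ← ih, Finset.mul_sum]
        exact Finset.sum_congr rfl fun w _ => walkWeight_cons R k.2 w
      · intro k _ hk
        rw [hR i k (by simpa using hk), zero_mul]
    · rintro ⟨x, hx⟩ - ⟨y, hy⟩ - hxy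
      rw [Function.onFun, disjoint_iff_inf_le]
      intro p hp
      simp only [Finset.inf_eq_inter, Finset.mem_inter, Finset.mem_map] at hp
      obtain ⟨⟨px, _, rfl⟩, ⟨py, hpy, hp⟩⟩ := hp
      cases hp
      simp at hxy

/-- Grouping the absolutely convergent walk-sum by length turns its blocks into entries of powers,
so the total walk-sum bounds all partial sums. -/
theorem IsWalkSummable.summable_absEdgeWeight_pow {G : SimpleGraph V} {J : Matrix V V ℝ}
    (hG : ∀ i j, i ≠ j → ¬ G.Adj i j → J i j = 0) (hdiag : ∀ i, J i i = 1)
    (hWS : IsWalkSummable G J) (i j : V) : Summable fun l => (absEdgeWeight J ^ l) i j := by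
  classical
  have hR : ∀ i j, ¬ G.Adj i j → absEdgeWeight J i j = 0 := by
    intro i j hij
    obtain rfl | h := eq_or_ne i j
    · simp [absEdgeWeight, edgeWeight, hdiag]
    · simp [absEdgeWeight, edgeWeight, h, hG i j h hij]
  have hs : Summable fun w : G.Walk i j => walkWeight (absEdgeWeight J) w := by
    simpa only [absEdgeWeight, ← abs_walkWeight] using (hWS i j).abs
  have hw0 : ∀ w : G.Walk i j, 0 ≤ walkWeight (absEdgeWeight J) w := fun w => by
    rw [absEdgeWeight, ← abs_walkWeight]
    exact abs_nonneg _
  refine summable_of_sum_range_le (c := ∑' w : G.Walk i j, walkWeight (absEdgeWeight J) w)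
    (fun l => Matrix.pow_apply_nonneg (fun i j => abs_nonneg _) l i j) fun n => ?_
  have hd : Set.PairwiseDisjoint (Finset.range n : Set ℕ) fun l => G.finsetWalkLength l i j := by
    intro a _ b _ hab
    rw [Function.onFun, Finset.disjoint_left]
    intro w hw hw'
    rw [SimpleGraph.mem_finsetWalkLength_iff] at hw hw'
    exact hab (hw.symm.trans hw')
  simp_rw [← sum_walkWeight_eq_pow_apply G hR]
  rw [← Finset.sum_biUnion hd]
  exact hs.sum_le_tsum _ fun w _ => hw0 w

end WalkSums

/-! ### Monotone convergence of the precision messages -/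

section PrecisionMessages

variable {V : Type*} [Fintype V]

/-- The cavity precision `1 - ∑ X (k → i)`, over `k ≠ j`, of a unit-diagonal model. -/
def cavityPrecision (X : V → V → ℝ) (i j : V) : ℝ := 1 - ∑ k, X k i + X j i

/-- The negated precision messages of loopy belief propagation for edge weights of absolute
values `A`. -/
noncomputable def precisionMessage (A : Matrix V V ℝ) : ℕ → V → V → ℝ
  | 0 => fun _ _ => 0
  | t + 1 => fun i j => A i j ^ 2 / cavityPrecision (precisionMessage A t) i j

/-- `v` certifies that `1 - A` is diagonally dominant up to scaling. -/
structure IsDominating (A : Matrix V V ℝ) (v : V → ℝ) : Prop where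
  symm : ∀ i j, A i j = A j i
  nonneg : ∀ i j, 0 ≤ A i j
  one_le : ∀ i, 1 ≤ v i
  eq : ∀ i, v i = 1 + ∑ k, A i k * v k

/-- The messages `X` lie between zero and the messages of the certificate `v`. -/
structure IsMessageBounded (A : Matrix V V ℝ) (v : V → ℝ) (X : V → V → ℝ) : Prop where
  nonneg : ∀ i j, 0 ≤ X i j
  le : ∀ i j, X i j * v j ≤ A i j * v i

variable {A : Matrix V V ℝ} {v : V → ℝ} {X Y : V → V → ℝ}

theorem IsDominating.pos (hv : IsDominating A v) (i : V) : 0 < v i :=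
  one_pos.trans_le (hv.one_le i)

theorem sum_sub_le_sum_sub {f g : V → ℝ} (h : ∀ k, f k ≤ g k) (j : V) :
    ∑ k, f k - f j ≤ ∑ k, g k - g j := by
  classical
  rw [← Finset.add_sum_erase _ f (Finset.mem_univ j), ← Finset.add_sum_erase _ g (Finset.mem_univ j),
    add_sub_cancel_left, add_sub_cancel_left]
  exact Finset.sum_le_sum fun k _ => h k

theorem abs_sum_sub_le {f g : V → ℝ} (h : ∀ k, |f k| ≤ g k) (j : V) :
    |∑ k, f k - f j| ≤ ∑ k, g k - g j := by
  have h1 := sum_sub_le_sum_sub (fun k => (abs_le.mp (h k)).2) j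
  have h2 := sum_sub_le_sum_sub (f := fun k => - g k) (fun k => (abs_le.mp (h k)).1) j
  rw [Finset.sum_neg_distrib] at h2
  exact abs_le.mpr ⟨by linarith, h1⟩

theorem cavityPrecision_anti (h : ∀ i j, X i j ≤ Y i j) (i j : V) :
    cavityPrecision Y i j ≤ cavityPrecision X i j := by
  have := sum_sub_le_sum_sub (fun k => h k i) j
  unfold cavityPrecision
  linarith

/-- Multiplied by v i, each subtracted X k i costs at most A i k * v k; what remains of v i = 1 + ∑
A i k * v k is 1 and the term of the omitted k = j. -/
theorem IsMessageBounded.le_cavityPrecision (hX : IsMessageBounded A v X) (hv : IsDominating A v)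
    (i j : V) : 1 + A i j * v j ≤ cavityPrecision X i j * v i := by
  have h1 := sum_sub_le_sum_sub (fun k => hX.le k i) j
  have h2 := hv.eq i
  simp_rw [hv.symm i] at h2 ⊢
  rw [← Finset.sum_mul] at h1
  unfold cavityPrecision
  nlinarith

theorem IsMessageBounded.cavityPrecision_pos (hX : IsMessageBounded A v X)
    (hv : IsDominating A v) (i j : V) : 0 < cavityPrecision X i j := by
  have h1 := hX.le_cavityPrecision hv i j
  have h2 := mul_nonneg (hv.nonneg i j) (hv.pos j).le
  exact pos_of_mul_pos_left (by linarith) (hv.pos i).le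

theorem IsMessageBounded.cavityPrecision_le_one (hX : IsMessageBounded A v X) (i j : V) :
    cavityPrecision X i j ≤ 1 := by
  have := Finset.single_le_sum (f := fun k => X k i) (fun k _ => hX.nonneg k i) (Finset.mem_univ j)
  unfold cavityPrecision
  linarith

theorem IsMessageBounded.one_le_mul_sub_sum (hX : IsMessageBounded A v X) (hv : IsDominating A v)
    (i : V) : 1 ≤ (1 - ∑ k, X k i) * v i := by
  have h1 := Finset.sum_le_sum fun k (_ : k ∈ Finset.univ) => hX.le k i
  have h2 := hv.eq i
  simp_rw [hv.symm i] at h2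
  rw [← Finset.sum_mul] at h1
  linarith

theorem IsMessageBounded.sub_sum_pos (hX : IsMessageBounded A v X) (hv : IsDominating A v)
    (i : V) : 0 < 1 - ∑ k, X k i :=
  pos_of_mul_pos_left (one_pos.trans_le (hX.one_le_mul_sub_sum hv i)) (hv.pos i).le

/-- The bound reproduces itself, since the cavity precision times v i is at least A i j * v j. -/
theorem isMessageBounded_precisionMessage (hv : IsDominating A v) (t : ℕ) :
    IsMessageBounded A v (precisionMessage A t) := by
  induction t with
  | zero =>
    exact ⟨fun _ _ => le_rfl, fun i j => by
      simpa [precisionMessage] using mul_nonneg (hv.nonneg i j) (hv.pos i).le⟩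
  | succ t ih =>
    refine ⟨fun i j => div_nonneg (sq_nonneg _) (ih.cavityPrecision_pos hv i j).le, fun i j => ?_⟩
    have h1 := ih.le_cavityPrecision hv i j
    rw [precisionMessage, div_mul_eq_mul_div, div_le_iff₀ (ih.cavityPrecision_pos hv i j)]
    nlinarith [hv.nonneg i j]

theorem precisionMessage_mono (hv : IsDominating A v) (i j : V) :
    Monotone fun t => precisionMessage A t i j := by
  refine monotone_nat_of_le_succ fun t => ?_
  induction t generalizing i j with
  | zero => exact (isMessageBounded_precisionMessage hv 1).nonneg i j
  | succ t ih =>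
    exact div_le_div_of_nonneg_left (sq_nonneg _)
      ((isMessageBounded_precisionMessage hv (t + 1)).cavityPrecision_pos hv i j)
      (cavityPrecision_anti ih i j)

theorem tendsto_cavityPrecision {f : ℕ → V → V → ℝ}
    (h : ∀ i j, Tendsto (fun t => f t i j) atTop (𝓝 (X i j))) (i j : V) :
    Tendsto (fun t => cavityPrecision (f t) i j) atTop (𝓝 (cavityPrecision X i j)) :=
  (tendsto_const_nhds.sub (tendsto_finsetSum _ fun k _ => h k i)).add (h j i)

/-- The precision messages increase to a fixed point. -/
theorem exists_tendsto_precisionMessage (hv : IsDominating A v) :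
    ∃ X : V → V → ℝ, (∀ i j, Tendsto (fun t => precisionMessage A t i j) atTop (𝓝 (X i j))) ∧
      (∀ t i j, precisionMessage A t i j ≤ X i j) ∧ IsMessageBounded A v X ∧
      ∀ i j, X i j * cavityPrecision X i j = A i j ^ 2 := by
  have hb := isMessageBounded_precisionMessage hv
  have hbdd : ∀ i j, BddAbove (Set.range fun t => precisionMessage A t i j) := fun i j =>
    ⟨A i j * v i / v j, by
      rintro _ ⟨t, rfl⟩
      exact (le_div_iff₀ (hv.pos j)).mpr ((hb t).le i j)⟩
  have hlim := fun i j => tendsto_atTop_ciSup (precisionMessage_mono hv i j) (hbdd i j)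
  have hX : IsMessageBounded A v fun i j => ⨆ t, precisionMessage A t i j :=
    ⟨fun i j => ge_of_tendsto' (hlim i j) fun t => (hb t).nonneg i j,
      fun i j => le_of_tendsto' ((hlim i j).mul_const _) fun t => (hb t).le i j⟩
  refine ⟨_, hlim, fun t i j => le_ciSup (hbdd i j) t, hX, fun i j => ?_⟩
  rw [← eq_div_iff (hX.cavityPrecision_pos hv i j).ne']
  exact tendsto_nhds_unique ((hlim i j).comp (tendsto_add_atTop_nat 1))
    (tendsto_const_nhds.div (tendsto_cavityPrecision hlim i j) (hX.cavityPrecision_pos hv i j).ne')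

end PrecisionMessages

theorem tendsto_zero_of_succ_eq_mul_add {θ : ℝ} (h0 : 0 ≤ θ) (h1 : θ < 1) {δ E : ℕ → ℝ}
    (hδ : Tendsto δ atTop (𝓝 0)) (hE0 : ∀ t, 0 ≤ E t) (hE : ∀ t, E (t + 1) = θ * E t + δ t) :
    Tendsto E atTop (𝓝 0) := by
  rw [Metric.tendsto_atTop]
  intro ε hε
  have hθ : 0 < 1 - θ := by linarith
  -- With δ below this threshold the offset ε / 2 persists: θ * (ε / 2) + (1 - θ) * (ε / 2) = ε / 2.
  obtain ⟨N, hN⟩ := Metric.tendsto_atTop.mp hδ (ε / 2 * (1 - θ)) (by positivity)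
  have key : ∀ n, E (N + n) ≤ θ ^ n * E N + ε / 2 := by
    intro n
    induction n with
    | zero => simp; positivity
    | succ n ih =>
      have h2 := hN (N + n) (by omega)
      rw [Real.dist_eq, sub_zero] at h2
      have h3 := mul_le_mul_of_nonneg_left ih h0
      rw [← add_assoc, hE, pow_succ]
      nlinarith [le_abs_self (δ (N + n))]
  have h4 : Tendsto (fun n => θ ^ n * E N) atTop (𝓝 0) := by
    simpa using (tendsto_pow_atTop_nhds_zero_of_lt_one h0 h1).mul_const (E N)
  obtain ⟨K, hK⟩ := Metric.tendsto_atTop.mp h4 (ε / 2) (by positivity)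
  refine ⟨N + K, fun n hn => ?_⟩
  obtain ⟨m, rfl⟩ := Nat.exists_eq_add_of_le (show N ≤ n by omega)
  have h5 := hK m (by omega)
  rw [Real.dist_eq, sub_zero] at h5 ⊢
  rw [abs_of_nonneg (hE0 _)]
  linarith [key m, le_abs_self (θ ^ m * E N)]

/-! ### Convergence of the potential messages and exactness of the means -/

section PotentialMessages

variable {V : Type*} [Fintype V]

/-- The potential messages of loopy belief propagation with edge weights `R`, for a given sequence
of cavity precisions. -/
noncomputable def potentialMessage (R : Matrix V V ℝ) (c : ℕ → V → V → ℝ) (h : V → ℝ) :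
    ℕ → V → V → ℝ
  | 0 => fun _ _ => 0
  | t + 1 => fun i j => R i j / c t i j *
      (h i + (∑ k, potentialMessage R c h t k i - potentialMessage R c h t j i))

/-- The potential messages at equilibrium, in terms of the exact means `μ` and the precision
messages `X` at equilibrium. -/
def equilibriumMessage (R : Matrix V V ℝ) (X : V → V → ℝ) (μ : V → ℝ) (i j : V) : ℝ :=
  R i j * μ i - X i j * μ j

variable {A R : Matrix V V ℝ} {v : V → ℝ} {X : V → V → ℝ}

/-- The terms R k i * μ k sum to μ i - h i. Dividing by 1 - ∑ X k i shows that the mean computed at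
equilibrium is μ i. -/
theorem add_sum_equilibriumMessage {h μ : V → ℝ} (hR : ∀ i j, R i j = R j i)
    (hμ : ∀ i, μ i = h i + ∑ k, R i k * μ k) (i : V) :
    h i + ∑ k, equilibriumMessage R X μ k i = (1 - ∑ k, X k i) * μ i := by
  simp only [equilibriumMessage, Finset.sum_sub_distrib, ← Finset.sum_mul]
  have := hμ i
  simp_rw [hR i] at this
  linarith

theorem equilibriumMessage_fixed {h μ : V → ℝ} (hR : ∀ i j, R i j = R j i)
    (hμ : ∀ i, μ i = h i + ∑ k, R i k * μ k) {i j : V} (hc : cavityPrecision X i j ≠ 0)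
    (hfix : X i j * cavityPrecision X i j = R i j ^ 2) :
    equilibriumMessage R X μ i j = R i j / cavityPrecision X i j *
      (h i + (∑ k, equilibriumMessage R X μ k i - equilibriumMessage R X μ j i)) := by
  rw [← add_sub_assoc, add_sum_equilibriumMessage hR hμ, div_mul_eq_mul_div, eq_div_iff hc]
  have : (1 - ∑ k, X k i) * μ i - equilibriumMessage R X μ j i =
      cavityPrecision X i j * μ i - R i j * μ j := by
    rw [equilibriumMessage, cavityPrecision, hR i j]
    ring
  rw [this, equilibriumMessage]
  linear_combination (-μ j) * hfix

omit [Fintype V] in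
theorem IsMessageBounded.equilibriumMessage_nonneg (hX : IsMessageBounded A v X) (i j : V) :
    0 ≤ equilibriumMessage A X v i j :=
  sub_nonneg.mpr (hX.le i j)

theorem IsMessageBounded.sum_equilibriumMessage_nonneg (hX : IsMessageBounded A v X) (i j : V) :
    0 ≤ ∑ k, equilibriumMessage A X v k i - equilibriumMessage A X v j i :=
  sub_nonneg.mpr <| Finset.single_le_sum (f := fun k => equilibriumMessage A X v k i)
    (fun k _ => hX.equilibriumMessage_nonneg k i) (Finset.mem_univ j)

/-- The message belonging to v is the fixed point for the constant potential 1, with nonnegative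
incoming messages and cavity precision at most 1. Hence whatever is bounded by a multiple of A is
bounded by a multiple of this message, which can serve as a weight for errors. -/
theorem le_equilibriumMessage (hv : IsDominating A v) (hX : IsMessageBounded A v X)
    (hfix : ∀ i j, X i j * cavityPrecision X i j = A i j ^ 2) (i j : V) :
    A i j ≤ equilibriumMessage A X v i j := by
  have hc := hX.cavityPrecision_pos hv i j
  rw [equilibriumMessage_fixed hv.symm (h := fun _ => 1) hv.eq hc.ne' (hfix i j)]
  have h1 : A i j ≤ A i j / cavityPrecision X i j :=
    le_div_self (hv.nonneg i j) hc (hX.cavityPrecision_le_one i j)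
  refine h1.trans (le_mul_of_one_le_right ((hv.nonneg i j).trans h1) ?_)
  linarith [hX.sum_equilibriumMessage_nonneg i j]

/-- In the fixed-point equation for the potential 1, the source term is at least A i j, hence at
least a fraction 1 / M of the whole message, which is at most A i j * v i. Removing it leaves the
contraction factor. -/
theorem equilibriumMessage_contraction (hv : IsDominating A v) (hX : IsMessageBounded A v X)
    (hfix : ∀ i j, X i j * cavityPrecision X i j = A i j ^ 2) {M : ℝ} (hM : ∀ i, v i ≤ M)
    (hM1 : 1 ≤ M) (i j : V) :
    A i j / cavityPrecision X i j *
      (∑ k, equilibriumMessage A X v k i - equilibriumMessage A X v j i) ≤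
      (1 - 1 / M) * equilibriumMessage A X v i j := by
  have hc := hX.cavityPrecision_pos hv i j
  have h1 := equilibriumMessage_fixed hv.symm (h := fun _ => 1) hv.eq hc.ne' (hfix i j)
  have h2 : A i j ≤ A i j / cavityPrecision X i j :=
    le_div_self (hv.nonneg i j) hc (hX.cavityPrecision_le_one i j)
  have h3 : equilibriumMessage A X v i j ≤ A i j * M := by
    rw [equilibriumMessage]
    nlinarith [mul_nonneg (hX.nonneg i j) (hv.pos j).le,
      mul_le_mul_of_nonneg_left (hM i) (hv.nonneg i j)]
  have h4 : 1 / M * equilibriumMessage A X v i j ≤ A i j := by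
    rw [one_div_mul_eq_div, div_le_iff₀ (by linarith)]
    exact h3
  rw [mul_add, mul_one] at h1
  linarith

/-- The potential messages converge to the equilibrium messages, for any sequence of cavity
precisions that converges from above. -/
theorem tendsto_potentialMessage (hv : IsDominating A v) (hX : IsMessageBounded A v X)
    (hfix : ∀ i j, X i j * cavityPrecision X i j = A i j ^ 2) (hR : ∀ i j, R i j = R j i)
    (hRA : ∀ i j, |R i j| = A i j) {c : ℕ → V → V → ℝ}
    (hc : ∀ t i j, cavityPrecision X i j ≤ c t i j)
    (hct : ∀ i j, Tendsto (fun t => c t i j) atTop (𝓝 (cavityPrecision X i j)))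
    {h μ : V → ℝ} (hμ : ∀ i, μ i = h i + ∑ k, R i k * μ k) (i j : V) :
    Tendsto (fun t => potentialMessage R c h t i j) atTop (𝓝 (equilibriumMessage R X μ i j)) := by
  have hcp := hX.cavityPrecision_pos hv
  have hfixR : ∀ i j, X i j * cavityPrecision X i j = R i j ^ 2 := fun i j => by
    rw [hfix, ← hRA, sq_abs]
  set m := equilibriumMessage A X v with hm
  set D := equilibriumMessage R X μ with hD
  have hm0 : ∀ i j, 0 ≤ m i j := hX.equilibriumMessage_nonneg
  have hAm : ∀ i j, A i j ≤ m i j := le_equilibriumMessage hv hX hfix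
  obtain ⟨M, hM1, hM⟩ : ∃ M : ℝ, 1 ≤ M ∧ ∀ i, v i ≤ M := by
    refine ⟨1 + ∑ i, v i, ?_, fun i => ?_⟩
    · linarith [Finset.sum_nonneg fun i (_ : i ∈ Finset.univ) => (hv.pos i).le]
    · have := Finset.single_le_sum (f := v) (fun k _ => (hv.pos k).le) (Finset.mem_univ i)
      linarith
  have hθ0 : 0 ≤ 1 - 1 / M := by
    rw [sub_nonneg, div_le_one (by linarith)]
    exact hM1
  have hθ1 : 1 - 1 / M < 1 := by
    have : 0 < 1 / M := by positivity
    linarith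
  -- The perturbation caused by using the current cavity precisions instead of their limits.
  let δ : ℕ → ℝ := fun t => ∑ i, ∑ j, |1 / c t i j - 1 / cavityPrecision X i j| *
    |h i + (∑ k, D k i - D j i)|
  have hδ0 : ∀ t, 0 ≤ δ t := fun t => by positivity
  have hδ : Tendsto δ atTop (𝓝 0) := by
    have : Tendsto δ atTop (𝓝 (∑ i, ∑ j, |1 / cavityPrecision X i j - 1 / cavityPrecision X i j| *
        |h i + (∑ k, D k i - D j i)|)) :=
      tendsto_finsetSum _ fun i _ => tendsto_finsetSum _ fun j _ =>
        (((tendsto_const_nhds.div (hct i j) (hcp i j).ne').sub_const _).abs).mul_const _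
    simpa using this
  -- Chosen so that the initial error |D i j| is at most K * A i j, by X i j = A i j ^ 2 /
  -- cavityPrecision X i j.
  let K : ℝ := ∑ i, ∑ j, (|μ i| + A i j / cavityPrecision X i j * |μ j|)
  let E : ℕ → ℝ := fun t => Nat.rec K (fun t e => (1 - 1 / M) * e + δ t) t
  have hK : ∀ i j, |μ i| + A i j / cavityPrecision X i j * |μ j| ≤ K := by
    have hn : ∀ i j, 0 ≤ |μ i| + A i j / cavityPrecision X i j * |μ j| := fun i j =>
      add_nonneg (abs_nonneg _)
        (mul_nonneg (div_nonneg (hv.nonneg i j) (hcp i j).le) (abs_nonneg _))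
    intro i j
    exact (Finset.single_le_sum (f := fun j => |μ i| + A i j / cavityPrecision X i j * |μ j|)
      (fun j _ => hn i j) (Finset.mem_univ j)).trans
      (Finset.single_le_sum (f := fun i => ∑ j, (|μ i| + A i j / cavityPrecision X i j * |μ j|))
        (fun i _ => Finset.sum_nonneg fun j _ => hn i j) (Finset.mem_univ i))
  have hE0 : ∀ t, 0 ≤ E t := by
    intro t
    induction t with
    | zero =>
      exact Finset.sum_nonneg fun i _ => Finset.sum_nonneg fun j _ => add_nonneg (abs_nonneg _)
        (mul_nonneg (div_nonneg (hv.nonneg i j) (hcp i j).le) (abs_nonneg _))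
    | succ t ih => exact add_nonneg (mul_nonneg hθ0 ih) (hδ0 t)
  have key : ∀ t i j, |potentialMessage R c h t i j - D i j| ≤ E t * m i j := by
    intro t
    induction t with
    | zero =>
      intro i j
      have hXij : X i j = A i j * (A i j / cavityPrecision X i j) := by
        rw [← mul_div_assoc, eq_div_iff (hcp i j).ne', hfix, sq]
      have h1 : |D i j| ≤ A i j * (|μ i| + A i j / cavityPrecision X i j * |μ j|) := by
        rw [hD, equilibriumMessage]
        refine (abs_sub _ _).trans ?_
        rw [abs_mul, abs_mul, hRA, abs_of_nonneg (hX.nonneg i j), hXij]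
        exact le_of_eq (by ring)
      have h2 : A i j * (|μ i| + A i j / cavityPrecision X i j * |μ j|) ≤ m i j * K :=
        mul_le_mul (hAm i j) (hK i j) (add_nonneg (abs_nonneg _)
          (mul_nonneg (div_nonneg (hv.nonneg i j) (hcp i j).le) (abs_nonneg _))) (hm0 i j)
      have h3 : E 0 = K := rfl
      rw [h3, mul_comm K, potentialMessage, zero_sub, abs_neg]
      exact h1.trans h2
    | succ t ih =>
      intro i j
      have hct0 : 0 < c t i j := (hcp i j).trans_le (hc t i j)
      have h1 : potentialMessage R c h (t + 1) i j - D i j =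
          R i j / c t i j * (∑ k, (potentialMessage R c h t k i - D k i) -
            (potentialMessage R c h t j i - D j i)) +
          R i j * ((1 / c t i j - 1 / cavityPrecision X i j) * (h i + (∑ k, D k i - D j i))) := by
        have h2 : D i j = R i j / cavityPrecision X i j * (h i + (∑ k, D k i - D j i)) :=
          equilibriumMessage_fixed hR hμ (hcp i j).ne' (hfixR i j)
        conv_lhs => rw [h2]
        rw [potentialMessage, Finset.sum_sub_distrib]
        ring
      have h3 : |∑ k, (potentialMessage R c h t k i - D k i) -
          (potentialMessage R c h t j i - D j i)| ≤ E t * (∑ k, m k i - m j i) := by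
        refine (abs_sum_sub_le (fun k => ih k i) j).trans (le_of_eq ?_)
        rw [← Finset.mul_sum, mul_sub]
      have h4 : |(1 / c t i j - 1 / cavityPrecision X i j) * (h i + (∑ k, D k i - D j i))| ≤ δ t := by
        rw [abs_mul]
        exact (Finset.single_le_sum (f := fun j => |1 / c t i j - 1 / cavityPrecision X i j| *
          |h i + (∑ k, D k i - D j i)|) (fun j _ => by positivity) (Finset.mem_univ j)).trans
          (Finset.single_le_sum (f := fun i => ∑ j, |1 / c t i j - 1 / cavityPrecision X i j| *
          |h i + (∑ k, D k i - D j i)|) (fun i _ => by positivity) (Finset.mem_univ i))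
      have h5 : |R i j / c t i j| ≤ A i j / cavityPrecision X i j := by
        rw [abs_div, hRA, abs_of_pos hct0]
        exact div_le_div_of_nonneg_left (hv.nonneg i j) (hcp i j) (hc t i j)
      rw [h1]
      refine (abs_add_le _ _).trans ?_
      rw [abs_mul, abs_mul (R i j), hRA]
      calc _ ≤ A i j / cavityPrecision X i j * (E t * (∑ k, m k i - m j i)) + m i j * δ t :=
            add_le_add (mul_le_mul h5 h3 (abs_nonneg _) ((abs_nonneg _).trans h5))
              (mul_le_mul (hAm i j) h4 (abs_nonneg _) (hm0 i j))
        _ = E t * (A i j / cavityPrecision X i j * (∑ k, m k i - m j i)) + m i j * δ t := by ring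
        _ ≤ E t * ((1 - 1 / M) * m i j) + m i j * δ t :=
            add_le_add_left (mul_le_mul_of_nonneg_left
              (equilibriumMessage_contraction hv hX hfix hM hM1 i j) (hE0 t)) _
        _ = ((1 - 1 / M) * E t + δ t) * m i j := by ring
  have hE : Tendsto E atTop (𝓝 0) :=
    tendsto_zero_of_succ_eq_mul_add hθ0 hθ1 hδ hE0 fun t => rfl
  rw [tendsto_iff_norm_sub_tendsto_zero]
  refine squeeze_zero (fun _ => norm_nonneg _) (fun t => key t i j) ?_
  simpa using hE.mul_const (m i j)

end PotentialMessages

/-! ### Non-backtracking expansions and the variance error -/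

section Comparison

variable {V : Type*} [Fintype V] {A R : Matrix V V ℝ} {v : V → ℝ} {X : V → V → ℝ}

theorem potentialMessage_nonneg {c : ℕ → V → V → ℝ} {e : V → ℝ} (hA : ∀ i j, 0 ≤ A i j)
    (hc : ∀ t i j, 0 ≤ c t i j) (he : ∀ i, 0 ≤ e i) (n : ℕ) (i j : V) :
    0 ≤ potentialMessage A c e n i j := by
  induction n generalizing i j with
  | zero => exact le_rfl
  | succ n ih =>
    refine mul_nonneg (div_nonneg (hA i j) (hc n i j)) (add_nonneg (he i) (sub_nonneg.mpr ?_))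
    exact Finset.single_le_sum (f := fun k => potentialMessage A c e n k i)
      (fun k _ => ih k i) (Finset.mem_univ j)

theorem abs_potentialMessage_le {c : ℕ → V → V → ℝ} {e : V → ℝ} (hRA : ∀ i j, |R i j| = A i j)
    (hc : ∀ t i j, 0 ≤ c t i j) (he : ∀ i, 0 ≤ e i) (n : ℕ) (i j : V) :
    |potentialMessage R c e n i j| ≤ potentialMessage A c e n i j := by
  induction n generalizing i j with
  | zero => simp [potentialMessage]
  | succ n ih =>
    have hA : 0 ≤ A i j := hRA i j ▸ abs_nonneg _
    rw [potentialMessage, potentialMessage, abs_mul, abs_div, hRA, abs_of_nonneg (hc n i j)]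
    refine mul_le_mul_of_nonneg_left ?_ (div_nonneg hA (hc n i j))
    refine (abs_add_le _ _).trans ?_
    rw [abs_of_nonneg (he i)]
    exact add_le_add_right (abs_sum_sub_le (fun k => ih k i) j) _

theorem potentialMessage_mono {c : V → V → ℝ} {e : V → ℝ} (hA : ∀ i j, 0 ≤ A i j)
    (hc : ∀ i j, 0 ≤ c i j) (he : ∀ i, 0 ≤ e i) (i j : V) :
    Monotone fun n => potentialMessage A (fun _ => c) e n i j := by
  refine monotone_nat_of_le_succ fun n => ?_
  induction n generalizing i j with
  | zero => exact potentialMessage_nonneg hA (fun _ => hc) he 1 i j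
  | succ n ih =>
    exact mul_le_mul_of_nonneg_left
      (add_le_add_right (sum_sub_le_sum_sub (fun k => ih k i) j) _)
      (div_nonneg (hA i j) (hc i j))

/-- The partial sums of the Neumann series are dominated by the non-backtracking expansion: every
walk of length at most `n` reduces to a non-backtracking walk of length at most `n`. -/
theorem neumann_mul_le (hv : IsDominating A v) (hX : IsMessageBounded A v X)
    (hfix : ∀ i j, X i j * cavityPrecision X i j = A i j ^ 2) {e : V → ℝ} (he : ∀ i, 0 ≤ e i)
    {p : ℕ → V → ℝ} (hp0 : ∀ j, p 0 j = e j)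
    (hp : ∀ n j, p (n + 1) j = e j + ∑ k, A j k * p n k) (n : ℕ) (j : V) :
    p n j * (1 - ∑ k, X k j) ≤
      e j + ∑ k, potentialMessage A (fun _ => cavityPrecision X) e n k j := by
  have hcp := hX.cavityPrecision_pos hv
  have hmono := potentialMessage_mono hv.nonneg (fun i j => (hcp i j).le) he
  have hb := hX.sub_sum_pos hv
  induction n generalizing j with
  | zero =>
    simp only [potentialMessage, Finset.sum_const_zero, add_zero, hp0]
    have := Finset.sum_nonneg fun k (_ : k ∈ Finset.univ) => hX.nonneg k j
    nlinarith [he j]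
  | succ n ih =>
    set W := potentialMessage A (fun _ => cavityPrecision X) e with hW
    set S := e j + ∑ k, W (n + 1) k j with hS
    -- With b j = 1 - ∑ X k j, summation over k gives p (n + 1) j ≤ S + (1 - b j) * S / b j = S / b
    -- j.
    have hstep : ∀ k, A j k * p n k ≤ W (n + 1) k j + X k j * (S / (1 - ∑ k, X k j)) := by
      intro k
      have h1 : W (n + 1) k j * cavityPrecision X k j =
          A k j * (e k + ∑ m, W n m k - W n j k) := by
        rw [hW, potentialMessage, add_sub_assoc]
        field_simp [(hcp k j).ne']
      -- By monotonicity W n may be replaced by W (n + 2), whose recursion produces S without the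
      -- message from k.
      have h2 : W n j k * cavityPrecision X j k ≤ A j k * (S - W (n + 1) k j) := by
        have h3 : W (n + 2) j k * cavityPrecision X j k = A j k * (S - W (n + 1) k j) := by
          rw [hS, add_sub_assoc, hW, potentialMessage]
          field_simp [(hcp j k).ne']
        rw [← h3]
        exact mul_le_mul_of_nonneg_right (hmono j k (by omega)) (hcp j k).le
      have h3 : A j k * W n j k ≤ X j k * (S - W (n + 1) k j) := by
        refine le_of_mul_le_mul_right ?_ (hcp j k)
        have := mul_le_mul_of_nonneg_left h2 (hv.nonneg j k)
        linear_combination this - (S - W (n + 1) k j) * hfix j k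
      have h4 : A j k * p n k * (1 - ∑ m, X m k) ≤
          W (n + 1) k j * (1 - ∑ m, X m k) + X j k * S := by
        have h5 := mul_le_mul_of_nonneg_left (ih k) (hv.nonneg j k)
        rw [hv.symm k j] at h1
        have h6 : cavityPrecision X k j = (1 - ∑ m, X m k) + X j k := rfl
        rw [h6] at h1
        linear_combination h5 + h3 - h1
      -- Both fixed-point equations have the right-hand side A j k ^ 2, and the product X j k * X k
      -- j cancels.
      have h5 : X j k * (1 - ∑ m, X m j) = X k j * (1 - ∑ m, X m k) := by
        have h6 := hfix j k
        have h7 := hfix k j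
        rw [hv.symm k j] at h7
        have h8 : cavityPrecision X k j = (1 - ∑ m, X m k) + X j k := rfl
        have h9 : cavityPrecision X j k = (1 - ∑ m, X m j) + X k j := rfl
        rw [h8] at h7
        rw [h9] at h6
        linear_combination h6 - h7
      refine le_of_mul_le_mul_right (h4.trans (le_of_eq ?_)) (hb k)
      have h6 : X j k * S = X k j * (1 - ∑ m, X m k) * S / (1 - ∑ m, X m j) := by
        rw [← h5, eq_div_iff (hb j).ne']
        ring
      rw [h6]
      ring
    rw [← le_div_iff₀ (hb j), hp]
    calc _ ≤ e j + ∑ k, (W (n + 1) k j + X k j * (S / (1 - ∑ k, X k j))) :=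
          add_le_add_right (Finset.sum_le_sum fun k _ => hstep k) _
      _ = S + (∑ k, X k j) * (S / (1 - ∑ k, X k j)) := by
          rw [Finset.sum_add_distrib, ← Finset.sum_mul, ← add_assoc]
      _ = S / (1 - ∑ k, X k j) := by
          have := (hb j).ne'
          field_simp
          ring

variable [DecidableEq V]

/-- Below the girth, a non-backtracking expansion only contains paths. -/
theorem exists_isPath_of_potentialMessage_ne_zero {G : SimpleGraph V}
    (hA : ∀ i j, ¬ G.Adj i j → A i j = 0) {c : ℕ → V → V → ℝ} {i : V} {n : ℕ} {k l : V}
    (hn : (n : ℕ∞) < G.egirth) (h : potentialMessage A c (Pi.single i 1) n k l ≠ 0) :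
    ∃ (hlk : G.Adj l k) (p : G.Walk k i), (SimpleGraph.Walk.cons hlk p).IsPath ∧ p.length < n := by
  induction n generalizing k l with
  | zero => exact absurd rfl h
  | succ n ih =>
    rw [potentialMessage] at h
    have hkl : G.Adj k l := by
      by_contra hc
      simp [hA k l hc] at h
    refine ⟨hkl.symm, ?_⟩
    have h1 := right_ne_zero_of_mul h
    rw [← Finset.add_sum_erase _ _ (Finset.mem_univ l), add_sub_cancel_left] at h1
    by_cases hk : k = i
    · subst hk
      exact ⟨SimpleGraph.Walk.nil, by simpa using hkl.ne', by simp⟩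
    · rw [Pi.single_eq_of_ne hk, zero_add] at h1
      obtain ⟨m, hm, hm0⟩ := Finset.exists_ne_zero_of_sum_ne_zero h1
      have hn' : (n : ℕ∞) < G.egirth := lt_of_le_of_lt (by exact_mod_cast n.le_succ) hn
      obtain ⟨hkm, q, hq, hlen⟩ := ih hn' hm0
      refine ⟨SimpleGraph.Walk.cons hkm q, ?_, by simpa using hlen⟩
      rw [SimpleGraph.Walk.cons_isPath_iff]
      refine ⟨hq, fun hl => ?_⟩
      rw [SimpleGraph.Walk.support_cons, List.mem_cons] at hl
      obtain hl | hl := hl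
      · exact hkl.ne' hl
      · rw [SimpleGraph.Walk.cons_isPath_iff] at hq
        have hpath : (SimpleGraph.Walk.cons hkm (q.takeUntil l hl)).IsPath := by
          rw [SimpleGraph.Walk.cons_isPath_iff]
          exact ⟨hq.1.takeUntil hl, fun hc => hq.2 (q.support_takeUntil_subset_support hl hc)⟩
        -- If l recurs on the path, then l, k, m and the path up to l close a cycle of length at
        -- most n + 1, below the girth; m ≠ l keeps the first edge from being repeated.
        have hcyc : (SimpleGraph.Walk.cons hkl.symm
            (SimpleGraph.Walk.cons hkm (q.takeUntil l hl))).IsCycle := by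
          rw [SimpleGraph.Walk.cons_isCycle_iff]
          refine ⟨hpath, fun hc => ?_⟩
          rw [SimpleGraph.Walk.edges_cons, List.mem_cons] at hc
          obtain hc | hc := hc
          · rw [Sym2.eq_swap, Sym2.congr_right] at hc
            exact Finset.ne_of_mem_erase hm hc.symm
          · exact hq.2 (q.support_takeUntil_subset_support hl
              (SimpleGraph.Walk.snd_mem_support_of_mem_edges _ hc))
        have h2 := SimpleGraph.egirth_le_length hcyc
        have h3 := q.length_takeUntil_le_length hl
        have h4 : (SimpleGraph.Walk.cons hkl.symm
            (SimpleGraph.Walk.cons hkm (q.takeUntil l hl))).length ≤ n + 1 := by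
          simp only [SimpleGraph.Walk.length_cons]
          omega
        exact absurd (h2.trans (by exact_mod_cast h4)) (not_le.mpr hn)

theorem potentialMessage_apply_self_eq_zero {G : SimpleGraph V}
    (hA : ∀ i j, ¬ G.Adj i j → A i j = 0) {c : ℕ → V → V → ℝ} {n : ℕ}
    (hn : (n : ℕ∞) < G.egirth) (i k : V) : potentialMessage A c (Pi.single i 1) n k i = 0 := by
  by_contra h
  obtain ⟨hik, p, hp, -⟩ := exists_isPath_of_potentialMessage_ne_zero hA hn h
  rw [SimpleGraph.Walk.cons_isPath_iff] at hp
  exact hp.2 p.end_mem_support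

/-- The variances from the precision messages at equilibrium differ from the exact variances by at
most the tail, from the girth on, of the Neumann series for the absolute edge weights. -/
theorem abs_inv_sub_le (hv : IsDominating A v) (hX : IsMessageBounded A v X)
    (hfix : ∀ i j, X i j * cavityPrecision X i j = A i j ^ 2) (hR : ∀ i j, R i j = R j i)
    (hRA : ∀ i j, |R i j| = A i j) {G : SimpleGraph V} (hA : ∀ i j, ¬ G.Adj i j → A i j = 0)
    (hsum : ∀ i j, Summable fun l => (A ^ l) i j) {n : ℕ} (hn : (n : ℕ∞) ≤ G.egirth)
    {i : V} {μ : V → ℝ} (hμ : ∀ j, μ j = (Pi.single i 1 : V → ℝ) j + ∑ k, R j k * μ k) :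
    |(1 - ∑ k, X k i)⁻¹ - μ i| ≤ ∑' l, (A ^ l) i i - ∑ l ∈ Finset.range n, (A ^ l) i i := by
  have hcp := hX.cavityPrecision_pos hv
  have hb := hX.sub_sum_pos hv i
  have he : ∀ j, (0 : ℝ) ≤ (Pi.single i 1 : V → ℝ) j := fun j => by
    rw [Pi.single_apply]
    split_ifs <;> norm_num
  have hone : ∀ j, (1 : Matrix V V ℝ) j i = (Pi.single i 1 : V → ℝ) j := fun j => by
    rw [Matrix.one_apply, Pi.single_apply]
  have hN : ∀ j, ∑' l, (A ^ l) j i =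
      (Pi.single i 1 : V → ℝ) j + ∑ k, A j k * ∑' l, (A ^ l) k i := fun j => by
    rw [Matrix.tsum_pow_apply_eq hsum, hone]
  -- The cavity precisions are frozen at their limits, so that the recursions for R and for A can be
  -- compared iterate by iterate.
  have hlim : ∀ {R' : Matrix V V ℝ} {μ' : V → ℝ}, (∀ i j, R' i j = R' j i) →
      (∀ i j, |R' i j| = A i j) →
      (∀ j, μ' j = (Pi.single i 1 : V → ℝ) j + ∑ k, R' j k * μ' k) → ∀ j k,
      Tendsto (fun t => potentialMessage R' (fun _ => cavityPrecision X) (Pi.single i 1) t j k) atTop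
        (𝓝 (equilibriumMessage R' X μ' j k)) := fun h1 h2 h3 j k =>
    tendsto_potentialMessage hv hX hfix h1 h2 (fun _ _ _ => le_rfl)
      (fun _ _ => tendsto_const_nhds) h3 j k
  have hdom : ∀ k, |equilibriumMessage R X μ k i| ≤
      equilibriumMessage A X (fun j => ∑' l, (A ^ l) j i) k i := fun k =>
    le_of_tendsto_of_tendsto' (hlim hR hRA hμ k i).abs
      (hlim hv.symm (fun i j => abs_of_nonneg (hv.nonneg i j)) hN k i)
      fun t => abs_potentialMessage_le hRA (fun _ i j => (hcp i j).le) he t k i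
  have h1 := add_sum_equilibriumMessage (X := X) hR hμ i
  have h2 := add_sum_equilibriumMessage (X := X) hv.symm hN i
  rw [Pi.single_eq_same] at h1 h2
  have h3 : |∑ k, equilibriumMessage R X μ k i| ≤
      ∑ k, equilibriumMessage A X (fun j => ∑' l, (A ^ l) j i) k i :=
    (Finset.abs_sum_le_sum_abs _ _).trans (Finset.sum_le_sum fun k _ => hdom k)
  have h4 : (∑ l ∈ Finset.range n, (A ^ l) i i) * (1 - ∑ k, X k i) ≤ 1 := by
    cases n with
    | zero => simp
    | succ n =>
      -- The index n stands for walks of length at most n, which is strictly below the girth.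
      have h5 := neumann_mul_le hv hX hfix he (p := fun n j => ∑ l ∈ Finset.range (n + 1), (A ^ l) j i)
        (fun j => by simp [hone]) (fun n j => by
          rw [Finset.sum_range_succ', pow_zero, hone, add_comm]
          congr 1
          simp_rw [pow_succ', Matrix.mul_apply, Finset.mul_sum]
          exact Finset.sum_comm) n i
      have hn' : (n : ℕ∞) < G.egirth :=
        lt_of_lt_of_le (by exact_mod_cast n.lt_succ_self) hn
      simpa [potentialMessage_apply_self_eq_zero hA hn'] using h5
  have h5 : ∑ k, equilibriumMessage R X μ k i = (1 - ∑ k, X k i) * (μ i - (1 - ∑ k, X k i)⁻¹) := by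
    rw [mul_sub, mul_inv_cancel₀ hb.ne', ← h1]
    ring
  rw [h5, abs_mul, abs_of_pos hb] at h3
  rw [abs_sub_comm]
  refine le_of_mul_le_mul_left ?_ hb
  linarith

end Comparison

/-! ### Loopy belief propagation in terms of the normalized messages -/

section LoopyBeliefPropagation

variable {V : Type*} [Fintype V]

theorem belief_eq_add_sum {G : SimpleGraph V} {a : V → ℝ} {m f : V → V → ℝ} {i : V}
    (hm : ∀ k, G.Adj k i → m k i = f k i) (hf : ∀ k, ¬ G.Adj k i → f k i = 0) :
    belief G a m i = a i + ∑ k, f k i := by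
  classical
  rw [belief, Finset.sum_filter]
  congr 1
  refine Finset.sum_congr rfl fun k _ => ?_
  rw [G.adj_comm]
  split_ifs with h
  exacts [hm k h, (hf k h).symm]

theorem cavity_eq_add_sum {G : SimpleGraph V} {a : V → ℝ} {m f : V → V → ℝ} {i : V}
    (hm : ∀ k, G.Adj k i → m k i = f k i) (hf : ∀ k, ¬ G.Adj k i → f k i = 0) (j : V) :
    cavity G a m i j = a i + (∑ k, f k i - f j i) := by
  classical
  rw [cavity, ← Finset.add_sum_erase _ _ (Finset.mem_univ j), add_sub_cancel_left]
  congr 1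
  rw [← Finset.filter_ne', Finset.sum_filter, Finset.sum_filter]
  refine Finset.sum_congr rfl fun k _ => ?_
  rw [G.adj_comm]
  by_cases h : G.Adj k i
  · simp [h, hm k h]
  · simp [h, hf k h]

theorem belief_congr {G : SimpleGraph V} {a : V → ℝ} {m m' : V → V → ℝ} {i : V}
    (hm : ∀ k, G.Adj k i → m k i = m' k i) : belief G a m i = belief G a m' i := by
  classical
  rw [belief, belief]
  congr 1
  refine Finset.sum_congr rfl fun k hk => hm k ?_
  exact (Finset.mem_filter.mp hk).2.symm

/-- Beliefs only see messages along edges, where limits are unique. This carries a bound for one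
constructed output over to every output. -/
theorem IsLBPOutput.unique {G : SimpleGraph V} {J : Matrix V V ℝ} {h μ P μ' P' : V → ℝ}
    (H : IsLBPOutput G J h μ P) (H' : IsLBPOutput G J h μ' P') : μ = μ' ∧ P = P' := by
  obtain ⟨-, ΔJ, Δh, h1, h2, -, h3, h4⟩ := H
  obtain ⟨-, ΔJ', Δh', h1', h2', -, h3', h4'⟩ := H'
  have hJ : ∀ i, belief G J.diag ΔJ i = belief G J.diag ΔJ' i := fun i =>
    belief_congr fun k hk => tendsto_nhds_unique (h1 k i hk) (h1' k i hk)
  have hh : ∀ i, belief G h Δh i = belief G h Δh' i := fun i =>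
    belief_congr fun k hk => tendsto_nhds_unique (h2 k i hk) (h2' k i hk)
  exact ⟨funext fun i => by rw [h4, h4', hJ, hh], funext fun i => by rw [h3, h3', hJ]⟩

theorem precisionMessage_eq_zero {A : Matrix V V ℝ} {i j : V} (h : A i j = 0) (t : ℕ) :
    precisionMessage A t i j = 0 := by
  cases t <;> simp [precisionMessage, h]

theorem potentialMessage_eq_zero {R : Matrix V V ℝ} {i j : V} (h : R i j = 0)
    (c : ℕ → V → V → ℝ) (a : V → ℝ) (t : ℕ) : potentialMessage R c a t i j = 0 := by
  cases t <;> simp [potentialMessage, h]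

variable [DecidableEq V] {G : SimpleGraph V} {J : Matrix V V ℝ}

omit [Fintype V] in
theorem edgeWeight_eq_zero (hG : ∀ i j, i ≠ j → ¬ G.Adj i j → J i j = 0)
    (hdiag : ∀ i, J i i = 1) {i j : V} (h : ¬ G.Adj i j) : edgeWeight J i j = 0 := by
  obtain rfl | hij := eq_or_ne i j
  · simp [edgeWeight, hdiag]
  · simp [edgeWeight, hij, hG i j hij h]

omit [Fintype V] in
theorem edgeWeight_apply_of_ne {i j : V} (h : i ≠ j) : edgeWeight J i j = -J i j := by
  simp [edgeWeight, h]

theorem cavity_lbpDeltaJ_of_eq {t : ℕ} (hG : ∀ i j, i ≠ j → ¬ G.Adj i j → J i j = 0)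
    (hdiag : ∀ i, J i i = 1)
    (h : ∀ i j, G.Adj i j → lbpDeltaJ G J t i j = -precisionMessage (absEdgeWeight J) t i j)
    (i j : V) : cavity G J.diag (lbpDeltaJ G J t) i j =
      cavityPrecision (precisionMessage (absEdgeWeight J) t) i j := by
  rw [cavity_eq_add_sum (f := fun i j => -precisionMessage (absEdgeWeight J) t i j)
    (fun k hk => h k i hk) fun k hk => ?_]
  · rw [Matrix.diag_apply, hdiag, cavityPrecision, Finset.sum_neg_distrib]
    ring
  · rw [precisionMessage_eq_zero, neg_zero]
    simp [absEdgeWeight, edgeWeight_eq_zero hG hdiag hk]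

theorem lbpDeltaJ_eq (hsymm : J.IsSymm) (hG : ∀ i j, i ≠ j → ¬ G.Adj i j → J i j = 0)
    (hdiag : ∀ i, J i i = 1) (t : ℕ) {i j : V} (hij : G.Adj i j) :
    lbpDeltaJ G J t i j = -precisionMessage (absEdgeWeight J) t i j := by
  induction t generalizing i j with
  | zero => simp [lbpDeltaJ, precisionMessage]
  | succ t ih =>
    rw [lbpDeltaJ]
    beta_reduce
    rw [cavity_lbpDeltaJ_of_eq hG hdiag (fun i j => ih), precisionMessage]
    beta_reduce
    have h1 : absEdgeWeight J i j ^ 2 = J i j ^ 2 := by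
      rw [absEdgeWeight, Matrix.map_apply, sq_abs, edgeWeight_apply_of_ne hij.ne, neg_sq]
    rw [h1, hsymm.apply]
    ring

theorem cavity_lbpDeltaJ (hsymm : J.IsSymm) (hG : ∀ i j, i ≠ j → ¬ G.Adj i j → J i j = 0)
    (hdiag : ∀ i, J i i = 1) (t : ℕ) (i j : V) : cavity G J.diag (lbpDeltaJ G J t) i j =
      cavityPrecision (precisionMessage (absEdgeWeight J) t) i j :=
  cavity_lbpDeltaJ_of_eq hG hdiag (fun _ _ => lbpDeltaJ_eq hsymm hG hdiag t) i j

theorem lbpDeltaH_eq (hsymm : J.IsSymm) (hG : ∀ i j, i ≠ j → ¬ G.Adj i j → J i j = 0)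
    (hdiag : ∀ i, J i i = 1) (h : V → ℝ) (t : ℕ) {i j : V} (hij : G.Adj i j) :
    lbpDeltaH G J h t i j = potentialMessage (edgeWeight J)
      (fun t => cavityPrecision (precisionMessage (absEdgeWeight J) t)) h t i j := by
  induction t generalizing i j with
  | zero => rfl
  | succ t ih =>
    rw [lbpDeltaH]
    beta_reduce
    rw [cavity_lbpDeltaJ hsymm hG hdiag, potentialMessage,
      cavity_eq_add_sum (fun k hk => ih hk)
        fun k hk => potentialMessage_eq_zero (edgeWeight_eq_zero hG hdiag hk) _ _ _,
      hsymm.apply]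
    beta_reduce
    rw [edgeWeight_apply_of_ne hij.ne, div_eq_mul_inv]

omit [Fintype V] in
theorem isHermitian_absEdgeWeight (hsymm : J.IsSymm) : (absEdgeWeight J).IsHermitian := by
  ext i j
  simp [absEdgeWeight, edgeWeight, Matrix.one_apply, hsymm.apply, eq_comm]

theorem isDominating_absEdgeWeight (hsymm : J.IsSymm)
    (hsum : ∀ i j, Summable fun l => (absEdgeWeight J ^ l) i j) :
    IsDominating (absEdgeWeight J) fun i => ∑ j, ∑' l, (absEdgeWeight J ^ l) i j := by
  have h0 : ∀ i j, 0 ≤ absEdgeWeight J i j := fun i j => abs_nonneg _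
  have heq : ∀ i, ∑ j, ∑' l, (absEdgeWeight J ^ l) i j =
      1 + ∑ k, absEdgeWeight J i k * ∑ j, ∑' l, (absEdgeWeight J ^ l) k j := by
    intro i
    simp_rw [Matrix.tsum_pow_apply_eq hsum i, Finset.sum_add_distrib, Finset.mul_sum]
    rw [Finset.sum_comm]
    simp [Matrix.one_apply]
  refine ⟨fun i j => by simpa using (isHermitian_absEdgeWeight hsymm).apply j i, h0,
    fun i => ?_, heq⟩
  simp only [heq i]
  exact le_add_of_nonneg_right <| Finset.sum_nonneg fun k _ => mul_nonneg (h0 i k) <|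
    Finset.sum_nonneg fun j _ => tsum_nonneg fun l => Matrix.pow_apply_nonneg h0 l k j

/-- Loopy belief propagation on a walk-summable model converges, its means are exact, and its
variances are exact up to a tail of the geometric series of the spectral radius. -/
theorem exists_isLBPOutput (hJ : J.PosDef) (hG : ∀ i j, i ≠ j → ¬ G.Adj i j → J i j = 0)
    (hdiag : ∀ i, J i i = 1) (hsum : ∀ i j, Summable fun l => (absEdgeWeight J ^ l) i j) :
    ∃ P : V → ℝ, (∀ h, IsLBPOutput G J h (J⁻¹.mulVec h) P) ∧
      ∀ i (n : ℕ), (n : ℕ∞) ≤ G.egirth →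
        |P i - J⁻¹ i i| ≤ absSpectralRadius J ^ n / (1 - absSpectralRadius J) := by
  have hsymm : J.IsSymm := hJ.isHermitian
  have hv := isDominating_absEdgeWeight hsymm hsum
  obtain ⟨X, hlim, hle, hX, hfix⟩ := exists_tendsto_precisionMessage hv
  have hR : ∀ i j, edgeWeight J i j = edgeWeight J j i := fun i j => by
    simp [edgeWeight, Matrix.one_apply, hsymm.apply, eq_comm]
  have hRA : ∀ i j, |edgeWeight J i j| = absEdgeWeight J i j := fun _ _ => rfl
  have hA : ∀ i j, ¬ G.Adj i j → absEdgeWeight J i j = 0 := fun i j hij => by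
    rw [← hRA, edgeWeight_eq_zero hG hdiag hij, abs_zero]
  have hX0 : ∀ i j, ¬ G.Adj i j → X i j = 0 := fun i j hij => by
    refine tendsto_nhds_unique (hlim i j) ?_
    simp only [precisionMessage_eq_zero (hA i j hij)]
    exact tendsto_const_nhds
  have hbelief : ∀ i, belief G J.diag (fun i j => -X i j) i = 1 - ∑ k, X k i := fun i => by
    rw [belief_eq_add_sum (f := fun i j => -X i j) (fun _ _ => rfl)
      fun k hk => by rw [hX0 k i hk, neg_zero], Matrix.diag_apply, hdiag, Finset.sum_neg_distrib,
      sub_eq_add_neg]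
  have hμ : ∀ (h : V → ℝ) i, J⁻¹.mulVec h i = h i + ∑ k, edgeWeight J i k * J⁻¹.mulVec h k := by
    intro h i
    have h1 : J.mulVec (J⁻¹.mulVec h) = h := by
      rw [Matrix.mulVec_mulVec, Matrix.mul_nonsing_inv _ ((Matrix.isUnit_iff_isUnit_det _).mp
        hJ.isUnit), Matrix.one_mulVec]
    have h2 : (edgeWeight J).mulVec (J⁻¹.mulVec h) i = J⁻¹.mulVec h i - h i := by
      rw [edgeWeight, Matrix.sub_mulVec, Matrix.one_mulVec, h1, Pi.sub_apply]
    rw [Matrix.mulVec, dotProduct] at h2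
    linarith
  refine ⟨fun i => (1 - ∑ k, X k i)⁻¹, fun h => ⟨fun t i j _ => ?_, fun i j => -X i j,
    equilibriumMessage (edgeWeight J) X (J⁻¹.mulVec h), fun i j hij => ?_, fun i j hij => ?_,
    fun i => ?_, fun i => ?_, fun i => ?_⟩, fun i n hn => ?_⟩
  · rw [cavity_lbpDeltaJ hsymm hG hdiag]
    exact ((isMessageBounded_precisionMessage hv t).cavityPrecision_pos hv i j).ne'
  · simp only [lbpDeltaJ_eq hsymm hG hdiag _ hij]
    exact (hlim i j).neg
  · simp only [lbpDeltaH_eq hsymm hG hdiag h _ hij]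
    exact tendsto_potentialMessage hv hX hfix hR hRA (fun t => cavityPrecision_anti (hle t))
      (tendsto_cavityPrecision hlim) (hμ h) i j
  · rw [hbelief]
    exact (hX.sub_sum_pos hv i).ne'
  · rw [hbelief]
  · rw [hbelief, belief_eq_add_sum (f := equilibriumMessage (edgeWeight J) X (J⁻¹.mulVec h))
      (fun _ _ => rfl) fun k hk => ?_, add_sum_equilibriumMessage hR (hμ h), ← mul_assoc,
      inv_mul_cancel₀ (hX.sub_sum_pos hv i).ne', one_mul]
    rw [equilibriumMessage, hX0 k i hk, edgeWeight_eq_zero hG hdiag hk]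
    ring
  -- The exact variance at i is the exact mean at i for the unit potential at i.
  · have h1 := abs_inv_sub_le hv hX hfix hR hRA hA hsum hn (hμ (Pi.single i 1))
    rw [Matrix.mulVec_single_one, Matrix.col_apply] at h1
    exact h1.trans ((isHermitian_absEdgeWeight hsymm).tsum_pow_apply_sub_le hsum n i)

theorem absSpectralRadius_lt_one (hsymm : J.IsSymm)
    (hsum : ∀ i j, Summable fun l => (absEdgeWeight J ^ l) i j) : absSpectralRadius J < 1 :=
  (isHermitian_absEdgeWeight hsymm).spectralRadius_lt_one fun i j => (hsum i j).tendsto_atTop_zero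

theorem powGirth_nonneg {ρ : ℝ} (hρ : 0 ≤ ρ) (g : ℕ∞) : 0 ≤ powGirth ρ g := by
  unfold powGirth
  split_ifs <;> positivity

theorem le_powGirth_div {ρ x : ℝ} {g : ℕ∞} (h0 : 0 ≤ ρ) (h1 : ρ < 1)
    (h : ∀ n : ℕ, (n : ℕ∞) ≤ g → x ≤ ρ ^ n / (1 - ρ)) : x ≤ powGirth ρ g / (1 - ρ) := by
  unfold powGirth
  split_ifs with hg
  -- For infinite girth the bound holds for every n, and its right-hand side tends to zero.
  · exact ge_of_tendsto' ((tendsto_pow_atTop_nhds_zero_of_lt_one h0 h1).div_const _)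
      fun n => h n (hg ▸ le_top)
  · exact h _ (ENat.natCast_toNat hg).le

/-- The nodewise form of the error bound for loopy belief propagation. -/
theorem exists_isLBPOutput_powGirth (hJ : J.PosDef)
    (hG : ∀ i j, i ≠ j → ¬ G.Adj i j → J i j = 0) (hdiag : ∀ i, J i i = 1)
    (hsum : ∀ i j, Summable fun l => (absEdgeWeight J ^ l) i j) :
    ∃ P : V → ℝ, (∀ h, IsLBPOutput G J h (J⁻¹.mulVec h) P) ∧
      ∀ i, |P i - J⁻¹ i i| ≤
        powGirth (absSpectralRadius J) G.egirth / (1 - absSpectralRadius J) := by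
  obtain ⟨P, h1, h2⟩ := exists_isLBPOutput hJ hG hdiag hsum
  exact ⟨P, h1, fun i => le_powGirth_div ENNReal.toReal_nonneg
    (absSpectralRadius_lt_one hJ.isHermitian hsum) (h2 i)⟩

end LoopyBeliefPropagation

/-! ### Block inversion with respect to the feedback nodes -/

section SchurComplement

variable {V : Type*} [Fintype V] [DecidableEq V] {J : Matrix V V ℝ} (F : Finset V)

/-- The block of `J` that couples the remaining nodes to the feedback nodes. -/
abbrev couplingInfo (J : Matrix V V ℝ) : Matrix {i // i ∉ F} {p // p ∈ F} ℝ :=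
  J.submatrix Subtype.val Subtype.val

/-- The Schur complement of the remaining nodes. -/
noncomputable abbrev schurInfo (J : Matrix V V ℝ) : Matrix {p // p ∈ F} {p // p ∈ F} ℝ :=
  J.submatrix Subtype.val Subtype.val -
    (couplingInfo F J).transpose * (remainingInfo J F)⁻¹ * couplingInfo F J

omit [Fintype V] [DecidableEq V] in
theorem posDef_remainingInfo (hJ : J.PosDef) : (remainingInfo J F).PosDef :=
  hJ.submatrix Subtype.val_injective

-- The swap `Equiv.sumComm` lists the remaining nodes first, so that the block to be eliminated is
-- the upper left one.
omit [Fintype V] in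
theorem submatrix_eq_fromBlocks (hsymm : J.IsSymm) :
    J.submatrix ((Equiv.sumComm _ _).trans (Equiv.sumCompl (· ∈ F)))
      ((Equiv.sumComm _ _).trans (Equiv.sumCompl (· ∈ F))) =
    Matrix.fromBlocks (remainingInfo J F) (couplingInfo F J) (couplingInfo F J).transpose
      (J.submatrix Subtype.val Subtype.val) := by
  ext (i | i) (j | j) <;> simp [hsymm.apply]

theorem isUnit_schurInfo (hJ : J.PosDef) : IsUnit (schurInfo F J) := by
  have := (posDef_remainingInfo F hJ).isUnit.invertible
  have hsymm : J.IsSymm := hJ.isHermitian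
  have h1 := hJ.isUnit
  rw [← Matrix.isUnit_submatrix_equiv ((Equiv.sumComm _ _).trans (Equiv.sumCompl (· ∈ F))),
    submatrix_eq_fromBlocks F hsymm, Matrix.isUnit_fromBlocks_iff_of_invertible₁₁,
    Matrix.invOf_eq_nonsing_inv] at h1
  exact h1

theorem inv_submatrix_eq_fromBlocks (hJ : J.PosDef) :
    J⁻¹.submatrix ((Equiv.sumComm _ _).trans (Equiv.sumCompl (· ∈ F)))
      ((Equiv.sumComm _ _).trans (Equiv.sumCompl (· ∈ F))) =
    Matrix.fromBlocks
      ((remainingInfo J F)⁻¹ + (remainingInfo J F)⁻¹ * couplingInfo F J * (schurInfo F J)⁻¹ *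
        (couplingInfo F J).transpose * (remainingInfo J F)⁻¹)
      (-((remainingInfo J F)⁻¹ * couplingInfo F J * (schurInfo F J)⁻¹))
      (-((schurInfo F J)⁻¹ * (couplingInfo F J).transpose * (remainingInfo J F)⁻¹))
      (schurInfo F J)⁻¹ := by
  have := (posDef_remainingInfo F hJ).isUnit.invertible
  have hsymm : J.IsSymm := hJ.isHermitian
  have h1 : IsUnit (J.submatrix Subtype.val Subtype.val -
    (couplingInfo F J).transpose * ⅟(remainingInfo J F) * couplingInfo F J) := by
    rw [Matrix.invOf_eq_nonsing_inv]
    exact isUnit_schurInfo F hJ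
  have := h1.invertible
  have := Matrix.fromBlocks₁₁Invertible (remainingInfo J F) (couplingInfo F J)
    (couplingInfo F J).transpose (J.submatrix Subtype.val Subtype.val)
  rw [← Matrix.inv_submatrix_equiv, submatrix_eq_fromBlocks F hsymm,
    ← Matrix.invOf_eq_nonsing_inv, Matrix.invOf_fromBlocks₁₁_eq]
  simp only [Matrix.invOf_eq_nonsing_inv]

theorem inv_apply_feedback (hJ : J.PosDef) (p : {p // p ∈ F}) :
    J⁻¹ p p = (schurInfo F J)⁻¹ p p := by
  simpa using congrFun (congrFun (inv_submatrix_eq_fromBlocks F hJ) (Sum.inr p)) (Sum.inr p)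

theorem inv_apply_remaining (hJ : J.PosDef) (i : {i // i ∉ F}) :
    J⁻¹ i i = (remainingInfo J F)⁻¹ i i +
      ∑ p : {p // p ∈ F}, ∑ q : {p // p ∈ F}, (remainingInfo J F)⁻¹.mulVec (fun j => J j p) i *
        (schurInfo F J)⁻¹ p q * (remainingInfo J F)⁻¹.mulVec (fun j => J j q) i := by
  have h1 := congrFun (congrFun (inv_submatrix_eq_fromBlocks F hJ) (Sum.inl i)) (Sum.inl i)
  have h2 : ((remainingInfo J F)⁻¹).IsSymm := (posDef_remainingInfo F hJ).isHermitian.inv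
  have h3 : (couplingInfo F J).transpose * (remainingInfo J F)⁻¹ =
      ((remainingInfo J F)⁻¹ * couplingInfo F J).transpose := by
    rw [Matrix.transpose_mul, h2.eq]
  rw [Matrix.mul_assoc _ (couplingInfo F J).transpose, h3] at h1
  have h4 : ∀ p : {p // p ∈ F}, ((remainingInfo J F)⁻¹ * couplingInfo F J) i p =
      (remainingInfo J F)⁻¹.mulVec (fun j => J j p) i := fun p => rfl
  have h5 : J⁻¹ i i = ((remainingInfo J F)⁻¹ + (remainingInfo J F)⁻¹ * couplingInfo F J *
      (schurInfo F J)⁻¹ * ((remainingInfo J F)⁻¹ * couplingInfo F J).transpose) i i := h1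
  have h6 : ∀ q, ((remainingInfo J F)⁻¹ * couplingInfo F J * (schurInfo F J)⁻¹) i q =
      ∑ p : {p // p ∈ F}, (remainingInfo J F)⁻¹.mulVec (fun j => J j p) i *
        (schurInfo F J)⁻¹ p q := fun q => Matrix.mul_apply
  rw [h5, Matrix.add_apply, Matrix.mul_apply]
  simp_rw [Matrix.transpose_apply, h4, h6, Finset.sum_mul]
  rw [Finset.sum_comm]

/-- Nodes inside and outside F are distinct, so `hG` kills the terms of non-neighbours and the
neighbour sums become matrix products. -/
theorem feedbackInfo_eq_schurInfo {G : SimpleGraph V}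
    (hG : ∀ i j, i ≠ j → ¬ G.Adj i j → J i j = 0) (hsymm : J.IsSymm) :
    feedbackInfo G J F (fun p => (remainingInfo J F)⁻¹.mulVec fun i => J i p) =
      schurInfo F J := by
  classical
  ext p q
  rw [feedbackInfo, Matrix.of_apply, schurInfo, Matrix.sub_apply, Matrix.mul_assoc,
    Matrix.mul_apply, Finset.sum_filter]
  congr 1
  refine Finset.sum_congr rfl fun j _ => ?_
  have h1 : (couplingInfo F J).transpose p j = J p j := hsymm.apply _ _
  rw [h1]
  split_ifs with h
  · rfl
  · rw [hG p j (fun hc => j.2 (hc ▸ p.2)) h, zero_mul]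

omit [Fintype V] in
theorem absEdgeWeight_remainingInfo :
    absEdgeWeight (remainingInfo J F) = (absEdgeWeight J).submatrix Subtype.val Subtype.val := by
  ext i j
  simp [absEdgeWeight, edgeWeight, Matrix.one_apply, Subtype.ext_iff]

end SchurComplement

/-! ### The error bounds -/

theorem proposition2 {V : Type*} [Fintype V] [DecidableEq V]
    (G : SimpleGraph V) (J : Matrix V V ℝ) (h : V → ℝ)
    (hJ : J.PosDef)
    (hG : ∀ i j, i ≠ j → ¬ G.Adj i j → J i j = 0)
    (hdiag : ∀ i, J i i = 1)
    (hWS : IsWalkSummable G J) :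
    (∀ F : Finset V,
      (∃ μ P : V → ℝ, IsApproxFMPOutput G J h F μ P) ∧
      ∀ μ P : V → ℝ, IsApproxFMPOutput G J h F μ P →
        varianceError J P ≤
          ((Fintype.card V : ℝ) - (F.card : ℝ)) / (Fintype.card V : ℝ) *
            (powGirth (absSpectralRadius (remainingInfo J F)) (remainingGraph G F).egirth /
              (1 - absSpectralRadius (remainingInfo J F)))) ∧
    ((∃ μ P : V → ℝ, IsLBPOutput G J h μ P) ∧
      ∀ μ P : V → ℝ, IsLBPOutput G J h μ P →
        varianceError J P ≤
          powGirth (absSpectralRadius J) G.egirth / (1 - absSpectralRadius J)) := by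
  have hsymm : J.IsSymm := hJ.isHermitian
  have hsum := hWS.summable_absEdgeWeight_pow hG hdiag
  refine ⟨fun F => ?_, ?_⟩
  · have hsumT : ∀ i j, Summable fun l => (absEdgeWeight (remainingInfo J F) ^ l) i j := by
      intro i j
      -- Summability passes to T because powers of a principal submatrix of a nonnegative matrix are
      -- entrywise at most those of the whole matrix.
      refine Summable.of_nonneg_of_le
        (fun l => Matrix.pow_apply_nonneg (fun i j => abs_nonneg _) l i j) (fun l => ?_) (hsum i j)
      rw [absEdgeWeight_remainingInfo]
      exact Matrix.submatrix_pow_apply_le (fun i j => abs_nonneg _) Subtype.val_injective l i j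
    obtain ⟨PT, hPT, herr⟩ := exists_isLBPOutput_powGirth (G := remainingGraph G F)
      (posDef_remainingInfo F hJ) (fun i j hij => hG i j fun hc => hij (Subtype.ext hc))
      (fun i => hdiag i) hsumT
    have hS := isUnit_schurInfo F hJ
    refine ⟨?_, ?_⟩
    · classical
      have hS' := hS
      rw [← feedbackInfo_eq_schurInfo F hG hsymm, Matrix.isUnit_iff_isUnit_det] at hS'
      have hglue : ∀ (a : {p // p ∈ F} → ℝ) (b : {i // i ∉ F} → ℝ),
          ∃ f : V → ℝ, (∀ p : {p // p ∈ F}, f p = a p) ∧ ∀ i : {i // i ∉ F}, f i = b i :=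
        fun a b => ⟨fun i => if hi : i ∈ F then a ⟨i, hi⟩ else b ⟨i, hi⟩,
          fun p => dif_pos p.2, fun i => dif_neg i.2⟩
      set g : {p // p ∈ F} → {i // i ∉ F} → ℝ :=
        fun p => (remainingInfo J F)⁻¹.mulVec fun i => J i p
      let PF := (feedbackInfo G J F g)⁻¹
      let μT := (remainingInfo J F)⁻¹.mulVec fun i => h i
      let μF := PF.mulVec (feedbackPotential G J h F μT)
      let νT := (remainingInfo J F)⁻¹.mulVec (revisedPotential G J h F μF)
      obtain ⟨μ, hμF, hμT⟩ := hglue μF νT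
      obtain ⟨P, hPF, hPT'⟩ :=
        hglue (fun p => PF p p) fun i => PT i + ∑ p, ∑ q, g p i * PF p q * g q i
      exact ⟨μ, P, μT, PT, νT, g, μF, PF, hPT _, fun p => hPT _, hS', rfl, rfl, hPT _,
        hμF, hμT, hPF, hPT'⟩
    · rintro μ P ⟨μT, PT', νT, g, μF, PF, h1, h2, -, rfl, -, -, -, -, hPF, hPT'⟩
      -- Uniqueness identifies the partial variances and the gains of an arbitrary output with those
      -- constructed.
      obtain rfl : PT' = PT := (h1.unique (hPT _)).2
      obtain rfl : g = fun p : {p // p ∈ F} => (remainingInfo J F)⁻¹.mulVec fun i => J i p :=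
        funext fun p => ((h2 p).unique (hPT _)).1
      rw [feedbackInfo_eq_schurInfo F hG hsymm] at hPF hPT'
      have hsplit : ∑ i, |P i - J⁻¹ i i| = ∑ p : {p // p ∈ F}, |P p - J⁻¹ p p| +
          ∑ i : {i // i ∉ F}, |P i - J⁻¹ i i| := by
        rw [← Fintype.sum_subtype_add_sum_subtype (· ∈ F)]
        congr!
      have h3 : ∑ p : {p // p ∈ F}, |P p - J⁻¹ p p| = 0 :=
        Finset.sum_eq_zero fun p _ => by rw [hPF, inv_apply_feedback F hJ, sub_self, abs_zero]
      have h4 : ∑ i : {i // i ∉ F}, |P i - J⁻¹ i i| ≤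
          ((Fintype.card V : ℝ) - (F.card : ℝ)) *
            (powGirth (absSpectralRadius (remainingInfo J F)) (remainingGraph G F).egirth /
              (1 - absSpectralRadius (remainingInfo J F))) := by
        have h5 := Finset.sum_le_card_nsmul Finset.univ (fun i : {i // i ∉ F} => |P i - J⁻¹ i i|) _
          fun i _ => by
            -- The feedback correction is exact and cancels, leaving the error of the partial
            -- variance.
            rw [hPT', inv_apply_remaining F hJ, add_sub_add_right_eq_sub]
            exact herr i
        have h6 : ((Fintype.card {i // i ∉ F} : ℕ) : ℝ) = Fintype.card V - F.card := by
          rw [Fintype.card_subtype_compl, Fintype.card_coe, Nat.cast_sub (Finset.card_le_univ F)]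
        rwa [Finset.card_univ, nsmul_eq_mul, h6] at h5
      rw [varianceError, hsplit, h3, zero_add, one_div, div_mul_eq_mul_div, div_eq_inv_mul]
      exact mul_le_mul_of_nonneg_left h4 (by positivity)
  · obtain ⟨P₀, hP₀, herr⟩ := exists_isLBPOutput_powGirth hJ hG hdiag hsum
    refine ⟨⟨_, P₀, hP₀ h⟩, fun μ P hP => ?_⟩
    obtain rfl : P = P₀ := (hP.unique (hP₀ h)).2
    have h1 := Finset.sum_le_card_nsmul Finset.univ (fun i => |P i - J⁻¹ i i|) _ fun i _ => herr i
    rw [Finset.card_univ, nsmul_eq_mul] at h1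
    have h2 : 0 ≤ powGirth (absSpectralRadius J) G.egirth / (1 - absSpectralRadius J) :=
      div_nonneg (powGirth_nonneg ENNReal.toReal_nonneg _)
        (sub_nonneg.mpr (absSpectralRadius_lt_one hsymm hsum).le)
    rw [varianceError]
    refine (mul_le_mul_of_nonneg_left h1 (by positivity)).trans ?_
    rw [← mul_assoc, one_div]
    -- An inequality suffices here and also covers the empty graph, where n⁻¹ * n = 0.
    exact mul_le_of_le_one_left h2 inv_mul_le_one
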